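/- Let $\mathbf k$ be an algebraically closed field of characteristic $0$, let $K^*$ be an algebraic function field of transcendence degree $2$ over $\mathbf k$, and let $\nu^*$ be a $\mathbf k$-valuation of $K^*$ with valuation ring $V^*$, whose value group is a subgroup of $\mathbb Q$ and whose residue field has transcendence degree $0$ over $\mathbf k$. Let $S$ be a regular local ring, essentially of finite type over $\mathbf k$, with quotient field $K^*$ and dominated by $V^*$. Let $(x,y)$ be regular parameters of $S$, with $\nu^*$ normalized so that $\nu^*(x)=1$. The jumping polynomials $T_i\in S$, with values $\beta_i=\nu^*(T_i)$, are defined as follows. Put $T_0=x$, $T_1=y$, $q_0=\infty$, and let $p_1,q_1$ be the coprime positive integers with $\nu^*(y)=p_1/q_1$. For $i\ge 1$ let $$T_{i+1}=T_i^{q_i}-\lambda_i\prod_{j=0}^{i-1}T_j^{n_{i,j}},$$ where the integers $0\le n_{i,j}<q_j$ satisfy $q_i\beta_i=\sum_{j=0}^{i-1}n_{i,j}\beta_j$ and $\lambda_i\in\mathbf k$ is the residue of $T_i^{q_i}/\prod_{j=0}^{i-1}T_j^{n_{i,j}}$; put $Q_i=q_1\cdots q_i$, and let $p_{i+1},q_{i+1}$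 be the coprime positive integers with $\beta_{i+1}=q_i\beta_i+\frac1{Q_i}\cdot\frac{p_{i+1}}{q_{i+1}}$. Let $\varepsilon(p,q)$ be the sum of the partial quotients in the Euclidean algorithm for $(p,q)$, and let $k_0=0$, $k_i=k_{i-1}+\varepsilon(p_i,q_i)$. A quadratic transform of a local ring $A$ along $\nu^*$ is the local ring of the blowing up of the maximal ideal of $A$ at the center of $\nu^*$. Let $E$ be the curve $x=0$ on $\operatorname{Spec}S$. For a sequence $S=S_0\to S_1\to\cdots$ of quadratic transforms along $\nu^*$, let $E_n$ be the reduced preimage of $E$ in $\operatorname{Spec}S_n$. The ring $S_n$ is free if $E_n$ has exactly one irreducible component, and a regular parameter of $S_n$ is exceptional if its divisor is supported on $E_n$. Theorem. The data above are well defined, and there is a sequence of quadratic transforms along $\nu^*$ of regular local rings dominated by $V^*$, $$S=S_0\to S_1\to\cdots\to S_{k_1}\to\cdots\to S_{k_i}\to\cdots,$$ such that for all $i>0$ the ring $S_{k_i}$ is free and has a system of regular parameters $(x_i,y_i)$ with the following properties: $x_i$ is an exceptional parameter; for all $0\le j\le i$ the number $Q_i\beta_j$ is a nonnegative integer and $T_j=x_i^{Q_i\beta_j}\gamma_{j,i}$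 with $\gamma_{j,i}$ a unit of $S_{k_i}$; $\nu^*(x_i)=\frac1{Q_i}$; the element $y_i=T_{i+1}/\prod_{j=0}^{i-1}T_j^{n_{i,j}}$ is the strict transform of $T_{i+1}$ in $S_{k_i}$; and $\nu^*(y_i)=\frac1{Q_i}\cdot\frac{p_{i+1}}{q_{i+1}}$. -/

import Mathlib

/-! Valuations are written additively. A valuation whose value group is a subgroup of the
rationals is an `AddValuation K (WithTop ℚ)`. Local rings with quotient field `K` are
`k`-subalgebras of `K`. -/

section Valuations

variable {k K : Type*} [Field k] [Field K] [Algebra k K]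

/-- `ν` is a `k`-valuation: it vanishes on the nonzero constants. -/
def IsKValuation (k : Type*) {K : Type*} [Field k] [Field K] [Algebra k K]
    (ν : AddValuation K (WithTop ℚ)) : Prop :=
  ∀ c : k, c ≠ 0 → ν (algebraMap k K c) = 0

theorem IsKValuation.nonneg {ν : AddValuation K (WithTop ℚ)} (h : IsKValuation k ν) (c : k) :
    0 ≤ ν (algebraMap k K c) := by
  by_cases hc : c = 0
  · simp [hc]
  · exact (h c hc).ge

/-- The valuation ring `V = {f | 0 ≤ ν f}` of a `k`-valuation, as a `k`-subalgebra of `K`. -/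
def valuationAlgebra (ν : AddValuation K (WithTop ℚ)) (h : IsKValuation k ν) :
    Subalgebra k K where
  carrier := {f | 0 ≤ ν f}
  mul_mem' := fun {a b} ha hb => by
    simp only [Set.mem_ofPred_eq] at *
    rw [AddValuation.map_mul]
    exact add_nonneg ha hb
  add_mem' := fun {a b} ha hb => AddValuation.map_le_add ν ha hb
  algebraMap_mem' := fun c => h.nonneg c

theorem AddValuation.val_inv_of_eq_zero (ν : AddValuation K (WithTop ℚ)) {a : K} (ha : ν a = 0) :
    a ≠ 0 ∧ ν a⁻¹ = 0 := by
  have h0 : a ≠ 0 := by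
    rintro rfl
    simp at ha
  refine ⟨h0, ?_⟩
  have h1 : ν (a * a⁻¹) = 0 := by
    rw [mul_inv_cancel₀ h0, AddValuation.map_one]
  rwa [AddValuation.map_mul, ha, zero_add] at h1

theorem valuationAlgebra_isUnit {ν : AddValuation K (WithTop ℚ)} {h : IsKValuation k ν}
    {a : valuationAlgebra ν h} (ha : ν (a : K) = 0) : IsUnit a := by
  obtain ⟨h0, h1⟩ := AddValuation.val_inv_of_eq_zero ν ha
  exact IsUnit.of_mul_eq_one ⟨(a : K)⁻¹, h1.ge⟩ (Subtype.ext (mul_inv_cancel₀ h0))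

instance valuationAlgebra_isLocalRing (ν : AddValuation K (WithTop ℚ)) (h : IsKValuation k ν) :
    IsLocalRing (valuationAlgebra ν h) := by
  refine IsLocalRing.of_isUnit_or_isUnit_of_isUnit_add ?_
  intro a b hab
  by_contra hcon
  rw [not_or] at hcon
  have pos : ∀ c : valuationAlgebra ν h, ¬ IsUnit c → 0 < ν (c : K) := fun c hc =>
    lt_of_le_of_ne c.2 fun h0 => hc (valuationAlgebra_isUnit h0.symm)
  have h1 : 0 < ν ((a : K) + b) := AddValuation.map_lt_add ν (pos a hcon.1) (pos b hcon.2)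
  obtain ⟨u, hu⟩ := hab.exists_right_inv
  have h2 : ν (((a : K) + b) * u) = 0 := by
    have := congrArg (fun z : valuationAlgebra ν h => ν (z : K)) hu
    simpa using this
  rw [AddValuation.map_mul] at h2
  exact absurd h2 (add_pos_of_pos_of_nonneg h1 u.2).ne'

/-- The transcendence degree over `k` of the residue field `V / m_V` is zero. -/
def IsZeroDimensional (ν : AddValuation K (WithTop ℚ)) (h : IsKValuation k ν) : Prop :=
  Algebra.trdeg k (IsLocalRing.ResidueField (valuationAlgebra ν h)) = 0

/-- The constant `c` is the residue of `f`, that is, `f - c` lies in the maximal ideal of the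
valuation ring. -/
def IsResidue (ν : AddValuation K (WithTop ℚ)) (f : K) (c : k) : Prop :=
  0 < ν (f - algebraMap k K c)

/-- The valuation ring of `ν` dominates `A`: it contains `A`, and the nonunits of `A` have
positive value. -/
def IsDominated (ν : AddValuation K (WithTop ℚ)) (A : Subalgebra k K) : Prop :=
  (∀ a : A, 0 ≤ ν (a : K)) ∧ ∀ a ∈ nonunits A, 0 < ν (a : K)

end Valuations

section RegularParameters

/-- `A` is a two-dimensional regular local ring, and its maximal ideal (the set of nonunits) is
generated by `x` and `y`. -/
structure IsRegularParameters {A : Type*} [CommRing A] (x y : A) : Prop where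
  regular : IsRegularLocalRing A
  dim : ringKrullDim A = 2
  span : (Ideal.span {x, y} : Set A) = nonunits A

end RegularParameters

section QuadraticTransforms

variable {k K : Type*} [Field k] [Field K] [Algebra k K]

/-- The localization of `A` at the center of `ν`: all fractions `a / b` with `a, b ∈ A` and
`ν b = 0`. -/
def localizationAlong (ν : AddValuation K (WithTop ℚ)) (A : Subalgebra k K) :
    Subalgebra k K where
  carrier := {f | ∃ a ∈ A, ∃ b ∈ A, ν b = 0 ∧ f = a / b}
  mul_mem' := by
    rintro _ _ ⟨a, ha, b, hb, hν, rfl⟩ ⟨a', ha', b', hb', hν', rfl⟩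
    refine ⟨a * a', A.mul_mem ha ha', b * b', A.mul_mem hb hb', ?_, ?_⟩
    · rw [AddValuation.map_mul, hν, hν', add_zero]
    · rw [div_mul_div_comm]
  add_mem' := by
    rintro _ _ ⟨a, ha, b, hb, hν, rfl⟩ ⟨a', ha', b', hb', hν', rfl⟩
    refine ⟨a * b' + b * a', A.add_mem (A.mul_mem ha hb') (A.mul_mem hb ha'), b * b',
      A.mul_mem hb hb', ?_, ?_⟩
    · rw [AddValuation.map_mul, hν, hν', add_zero]
    · exact div_add_div _ _ (AddValuation.val_inv_of_eq_zero ν hν).1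
        (AddValuation.val_inv_of_eq_zero ν hν').1
  algebraMap_mem' := fun c =>
    ⟨algebraMap k K c, A.algebraMap_mem c, 1, A.one_mem, AddValuation.map_one ν, by simp⟩

/-- `B` is the quadratic transform of the local ring `A` along `ν`: with `z` an element of minimal
value in the maximal ideal `m` of `A`, `B` is the localization of `A[m / z]` at the center
of `ν`, that is, the local ring of the blowing up of `m` at the center of `ν`. -/
def IsQuadraticTransform (ν : AddValuation K (WithTop ℚ)) (A B : Subalgebra k K) : Prop :=
  ∃ z ∈ nonunits A, z ≠ 0 ∧ (∀ w ∈ nonunits A, ν (z : K) ≤ ν (w : K)) ∧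
    B = localizationAlong ν
      (Algebra.adjoin k ((A : Set K) ∪ {f | ∃ w ∈ nonunits A, f = (w : K) / (z : K)}))

/-- `A = B 0 → B 1 → B 2 → ⋯` is a sequence of quadratic transforms along `ν` of regular local
rings dominated by the valuation ring. -/
structure IsQuadraticSequence (ν : AddValuation K (WithTop ℚ)) (A : Subalgebra k K)
    (B : ℕ → Subalgebra k K) : Prop where
  zero : B 0 = A
  step : ∀ n, IsQuadraticTransform ν (B n) (B (n + 1))
  regular : ∀ n, IsRegularLocalRing (B n)
  dominated : ∀ n, IsDominated ν (B n)

theorem IsQuadraticTransform.le {ν : AddValuation K (WithTop ℚ)} {A B : Subalgebra k K}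
    (h : IsQuadraticTransform ν A B) : A ≤ B := by
  obtain ⟨z, -, -, -, rfl⟩ := h
  intro a ha
  exact ⟨a, Algebra.subset_adjoin (Or.inl ha), 1, Subalgebra.one_mem _,
    AddValuation.map_one ν, by simp⟩

theorem IsQuadraticSequence.le {ν : AddValuation K (WithTop ℚ)} {A : Subalgebra k K}
    {B : ℕ → Subalgebra k K} (h : IsQuadraticSequence ν A B) (n : ℕ) : A ≤ B n := by
  induction n with
  | zero => exact h.zero.ge
  | succ n ih => exact ih.trans (h.step n).le

/-- The reduced preimage in `Spec B` of the curve `x = 0` on `Spec A`, where `A ⊆ B`. -/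
def curvePreimage {A B : Subalgebra k K} (h : A ≤ B) (x : A) : Set (PrimeSpectrum B) :=
  PrimeSpectrum.comap (Subalgebra.inclusion h).toRingHom ⁻¹' PrimeSpectrum.zeroLocus {x}

/-- `B` is free (with respect to the curve `x = 0` on `Spec A`): the preimage of the curve has
exactly one irreducible component. -/
def IsFreeRing {A B : Subalgebra k K} (h : A ≤ B) (x : A) : Prop :=
  ∃! Z, Z ∈ irreducibleComponents (curvePreimage h x)

/-- The divisor of `u ∈ B` is supported on the preimage of the curve `x = 0`. -/
def IsExceptional {A B : Subalgebra k K} (h : A ≤ B) (x : A) (u : B) : Prop :=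
  PrimeSpectrum.zeroLocus {u} ⊆ curvePreimage h x

/-- `g` is (an equation of) the strict transform in `Spec B` of the curve `f = 0` on `Spec A`:
the ideal `g B` is the saturation of `f B` by `m_A B`, which is the ideal of the closure of the
preimage of the curve without the closed point of `Spec A`. -/
def IsStrictTransform {A B : Subalgebra k K} [IsLocalRing A] (h : A ≤ B) (f : A) (g : B) : Prop :=
  ∀ a : B, a ∈ Ideal.span {g} ↔
    ∃ N : ℕ, ∀ e ∈ ((IsLocalRing.maximalIdeal A).map (Subalgebra.inclusion h).toRingHom) ^ N,
      e * a ∈ Ideal.span {Subalgebra.inclusion h f}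

end QuadraticTransforms

section JumpingPolynomials

/-- The sum of the partial quotients in the Euclidean algorithm for `p` and `q`. -/
def euclidSum (p q : ℕ) : ℕ :=
  if h : q = 0 then 0 else p / q + euclidSum q (p % q)
termination_by q
decreasing_by exact Nat.mod_lt _ (Nat.pos_of_ne_zero h)

/-- The recursive construction of the jumping polynomials `T i` of `x, y` with respect to `ν`
(normalized so that `ν x = 1`), together with their values `β i`, the coprime pairs
`(p i, q i)` for `i ≥ 1`, the exponents `n i j` for `j < i`, and the constants `c i` for `i ≥ 1`.
The numbers `p 0`, `q 0`, `c 0`, and `n i j` for `j ≥ i` or `i = 0`, play no role. -/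
structure JumpingSequence {k K : Type*} [Field k] [Field K] [Algebra k K]
    (ν : AddValuation K (WithTop ℚ)) {S : Subalgebra k K} (x y : S) where
  T : ℕ → S
  β : ℕ → ℚ
  p : ℕ → ℕ
  q : ℕ → ℕ
  n : ℕ → ℕ → ℕ
  c : ℕ → k
  T_zero : T 0 = x
  T_one : T 1 = y
  value : ∀ i, ν (T i : K) = (β i : WithTop ℚ)
  p_pos : ∀ i, 0 < i → 0 < p i
  q_pos : ∀ i, 0 < i → 0 < q i
  coprime : ∀ i, 0 < i → (p i).Coprime (q i)
  β_one : β 1 = (p 1 : ℚ) / q 1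
  /-- No bound on `n i 0`, since `q 0 = ∞` by convention. -/
  n_lt : ∀ i j, 0 < j → j < i → n i j < q j
  n_value : ∀ i, 0 < i → (q i : ℚ) * β i = ∑ j ∈ Finset.range i, (n i j : ℚ) * β j
  c_residue : ∀ i, 0 < i →
    IsResidue ν ((T i : K) ^ q i / ∏ j ∈ Finset.range i, (T j : K) ^ n i j) (c i)
  T_succ : ∀ i, 0 < i →
    T (i + 1) = T i ^ q i - algebraMap k S (c i) * ∏ j ∈ Finset.range i, T j ^ n i j
  β_succ : ∀ i, 0 < i →
    β (i + 1) = q i * β i +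
      1 / (∏ j ∈ Finset.Icc 1 i, (q j : ℚ)) * ((p (i + 1) : ℚ) / q (i + 1))

namespace JumpingSequence

variable {k K : Type*} [Field k] [Field K] [Algebra k K]
  {ν : AddValuation K (WithTop ℚ)} {S : Subalgebra k K} {x y : S}

/-- `Q i = q 1 ⋯ q i`. -/
def Q (J : JumpingSequence ν x y) (i : ℕ) : ℕ := ∏ j ∈ Finset.Icc 1 i, J.q j

/-- The index `k_i`, given by `k_0 = 0` and `k_i = k_{i-1} + ε (p i, q i)`. -/
def index (J : JumpingSequence ν x y) (i : ℕ) : ℕ :=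
  ∑ j ∈ Finset.Icc 1 i, euclidSum (J.p j) (J.q j)

end JumpingSequence

end JumpingPolynomials

/-! The argument follows a pair $u,v$ that generates the maximal ideal and forms a regular sequence
(`RegularSystem`). This notion can be checked by computing in $K$, and it gives back dimension two,
regularity and the primality of $u$ and $v$. One quadratic transform turns $u,v$ into $u,v/u$ when
$\nu(u)<\nu(v)$ (`blowUp`), and into $u,v/u-c$ when the values agree, where $c\in k$ is the residue
of $v/u$ (`quadraticTransform_of_eq`); $c$ exists because the residue field of $\nu$ is algebraic
over the algebraically closed field $k$.

On values this is the subtractive Euclidean algorithm. If $\nu(u):\nu(v)=q:p$ in lowest terms, the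
element $v^q/u^p$ of $K$ stays the same while the pair and the exponents change together. After
$\varepsilon(p,q)$ steps the parameters are $w$ and $v^q/u^p-c$, and $u,v$ are $w^q,w^p$ up to units
(`exists_iterate_quadraticTransform`).

Now induct on $i$ (`exists_regularSystem`). In $S_{k_i}$ the elements $T_0,\dots,T_i$ are powers of
$x_i$ times units, and $T_{i+1}$ is $y_i$ times a monomial in them. Hence $T_{i+1}^{q_{i+1}}/\prod_j
T_j^{n_{i+1,j}}$ is a unit times $y_i^{q_{i+1}}/x_i^{p_{i+1}}$, and subtracting its residue gives
$y_{i+1}$. The unit is absorbed by a change of parameters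
(`exists_iterate_quadraticTransform_unit_mul`).

Existence of the data uses the same induction: $y_i$ is a nonzero nonunit, so $T_{i+1}\ne 0$ and its
value exceeds $q_i\beta_i$; the exponents come from division modulo the $q_j$ (`exists_exponents`).
Freeness and the strict transform follow because $x_i$ and $y_i$ are prime and $y_i$ divides no
power of $x_i$. -/

/-! ### Local rings whose maximal ideal has one or two generators. -/

section LocalRings

open IsLocalRing

variable {R : Type*} [CommRing R] [IsNoetherianRing R] [IsLocalRing R]

/-- By Krull's intersection theorem a nonzero element lies in a last power of the maximal ideal; the
cofactor of that power of `v` cannot be a nonunit. -/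
theorem IsLocalRing.exists_eq_pow_mul_unit {v : R} (hm : maximalIdeal R = Ideal.span {v}) {a : R}
    (ha : a ≠ 0) : ∃ (n : ℕ) (e : R), IsUnit e ∧ a = v ^ n * e := by
  have hinf : ⨅ i : ℕ, maximalIdeal R ^ i = ⊥ :=
    Ideal.iInf_pow_eq_bot_of_isLocalRing _ (maximalIdeal.isMaximal R).ne_top
  have hex : ∃ n, a ∉ maximalIdeal R ^ n := by
    by_contra! hcon
    exact ha (by simpa [hinf] using (Ideal.mem_iInf.mpr hcon))
  classical
  obtain ⟨n, hn, hmin⟩ : ∃ n, a ∈ maximalIdeal R ^ n ∧ a ∉ maximalIdeal R ^ (n + 1) := by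
    have hpos : Nat.find hex ≠ 0 := fun h0 => by
      have := Nat.find_spec hex
      simp [h0] at this
    refine ⟨Nat.find hex - 1, ?_, ?_⟩
    · by_contra hcon
      exact Nat.find_min hex (Nat.sub_one_lt hpos) hcon
    · rw [Nat.sub_one_add_one hpos]
      exact Nat.find_spec hex
  rw [hm, Ideal.span_singleton_pow, Ideal.mem_span_singleton] at hn
  obtain ⟨e, rfl⟩ := hn
  refine ⟨n, e, ?_, rfl⟩
  by_contra he
  obtain ⟨f, rfl⟩ : v ∣ e := by
    rw [← Ideal.mem_span_singleton, ← hm]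
    exact (mem_maximalIdeal e).mpr he
  apply hmin
  rw [hm, Ideal.span_singleton_pow, Ideal.mem_span_singleton]
  exact ⟨f, by ring⟩

/-- Modulo `u` the maximal ideal is generated by the image of `v`, so nonzero elements are units
times powers of it. A zero divisor would make that image nilpotent, which `hv` excludes. -/
theorem IsLocalRing.prime_of_maximalIdeal_eq_span_pair {u v : R}
    (hm : maximalIdeal R = Ideal.span {u, v}) (hu : u ≠ 0) (hv : ∀ n : ℕ, ¬ u ∣ v ^ n) :
    Prime u := by
  have hun : ¬ IsUnit u := by
    rw [← mem_nonunits_iff, ← mem_maximalIdeal, hm]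
    exact Ideal.subset_span (by simp)
  have hne : Ideal.span {u} ≠ ⊤ := by rwa [Ne, Ideal.span_singleton_eq_top]
  have : Nontrivial (R ⧸ Ideal.span {u}) := Ideal.Quotient.nontrivial_iff.mpr hne
  have : IsLocalRing (R ⧸ Ideal.span {u}) :=
    IsLocalRing.of_surjective' (Ideal.Quotient.mk _) Ideal.Quotient.mk_surjective
  have hm' : maximalIdeal (R ⧸ Ideal.span {u}) =
      Ideal.span {Ideal.Quotient.mk (Ideal.span {u}) v} := by
    have hloc : IsLocalHom (Ideal.Quotient.mk (Ideal.span {u})) :=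
      IsLocalHom.of_surjective _ Ideal.Quotient.mk_surjective
    have h1 := ((local_hom_TFAE (Ideal.Quotient.mk (Ideal.span {u}))).out 0 4).mp hloc
    rw [← Ideal.map_comap_of_surjective (Ideal.Quotient.mk (Ideal.span {u}))
      Ideal.Quotient.mk_surjective (maximalIdeal _), h1, hm, Ideal.map_span, Set.image_pair,
      Ideal.Quotient.eq_zero_iff_mem.mpr (Ideal.mem_span_singleton_self u),
      Ideal.span_insert, Ideal.span_singleton_zero, bot_sup_eq]
  rw [← Ideal.span_singleton_prime hu, ← Ideal.Quotient.isDomain_iff_prime]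
  have : NoZeroDivisors (R ⧸ Ideal.span {u}) := by
    refine ⟨fun {a b} hab => ?_⟩
    by_contra! hcon
    obtain ⟨n, e, he, rfl⟩ := exists_eq_pow_mul_unit hm' hcon.1
    obtain ⟨n', e', he', rfl⟩ := exists_eq_pow_mul_unit hm' hcon.2
    apply hv (n + n')
    rw [← Ideal.mem_span_singleton, ← Ideal.Quotient.eq_zero_iff_mem, map_pow, pow_add]
    have : IsUnit (e * e') := he.mul he'
    rw [← this.mul_left_eq_zero, ← hab]
    ring
  exact NoZeroDivisors.to_isDomain _

/-- Otherwise the maximal ideal would be minimal over `u`, of height at most one by Krull's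
principal ideal theorem. -/
theorem IsLocalRing.not_dvd_pow_of_ringKrullDim_eq_two {u v : R}
    (hm : maximalIdeal R = Ideal.span {u, v}) (hdim : ringKrullDim R = 2) (n : ℕ) :
    ¬ u ∣ v ^ n := by
  intro hdvd
  have hmin : maximalIdeal R ∈ (Ideal.span {u}).minimalPrimes := by
    refine ⟨⟨inferInstance, ?_⟩, fun P hP _ => ?_⟩
    · rw [hm]
      exact Ideal.span_mono (by simp)
    · have hu : u ∈ P := hP.2 (Ideal.mem_span_singleton_self u)
      rw [hm, Ideal.span_le]
      rintro z (rfl | rfl)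
      · exact hu
      · exact hP.1.mem_of_pow_mem n (P.mem_of_dvd hdvd hu)
  have h1 := Ideal.height_le_one_of_isPrincipal_of_mem_minimalPrimes _ _ hmin
  rw [← maximalIdeal_height_eq_ringKrullDim] at hdim
  have h2 : (maximalIdeal R).height = 2 := WithBot.coe_injective hdim
  rw [h2] at h1
  exact absurd h1 (by decide)

/-- Two generators bound the height above; the chain `0 < (u) < m` bounds it below. -/
theorem IsLocalRing.ringKrullDim_eq_two [IsDomain R] {u v : R}
    (hm : maximalIdeal R = Ideal.span {u, v}) (hu : Prime u) (hv : ¬ u ∣ v) :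
    ringKrullDim R = 2 := by
  rw [← maximalIdeal_height_eq_ringKrullDim]
  have hle : (maximalIdeal R).height ≤ 2 := by
    refine (Ideal.height_le_spanFinrank _ (maximalIdeal.isMaximal R).ne_top).trans ?_
    rw [hm]
    exact_mod_cast (Submodule.spanFinrank_span_le_ncard_of_finite (Set.toFinite {u, v})).trans
      ((Set.ncard_insert_le u {v}).trans (by simp))
  have hpr : (Ideal.span {u}).IsPrime := (Ideal.span_singleton_prime hu.ne_zero).mpr hu
  have h1 : (⊥ : Ideal R) < Ideal.span {u} :=
    bot_lt_iff_ne_bot.mpr (by simpa using hu.ne_zero)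
  have h2 : Ideal.span {u} < maximalIdeal R := by
    refine lt_of_le_of_ne (le_maximalIdeal hpr.ne_top) fun h => hv ?_
    rw [← Ideal.mem_span_singleton, h, hm]
    exact Ideal.subset_span (by simp)
  have h3 := Ideal.height_add_one_le_of_lt_of_isPrime h1
  have h4 := Ideal.height_add_one_le_of_lt_of_isPrime h2
  have hge : 2 ≤ (maximalIdeal R).height := by
    calc (2 : ℕ∞) = 0 + 1 + 1 := by norm_num
      _ ≤ (⊥ : Ideal R).height + 1 + 1 := by gcongr; simp
      _ ≤ _ := (add_le_add_left h3 1).trans h4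
  rw [le_antisymm hle hge]
  rfl

theorem IsLocalRing.isRegularLocalRing_of_span_pair {u v : R}
    (hm : maximalIdeal R = Ideal.span {u, v}) (hdim : ringKrullDim R = 2) :
    IsRegularLocalRing R := by
  refine IsRegularLocalRing.of_spanFinrank_maximalIdeal_le R ?_
  rw [hdim, hm]
  exact_mod_cast (Submodule.spanFinrank_span_le_ncard_of_finite (Set.toFinite {u, v})).trans
      ((Set.ncard_insert_le u {v}).trans (by simp))

end LocalRings

/-! ### Regular systems of two parameters inside a valued field. -/

section RegularSystems

open IsLocalRing Polynomial

variable {k K : Type*} [Field k] [Field K] [Algebra k K]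

/-- `A` is a noetherian local ring dominated by the valuation ring of `ν`, and its maximal ideal is
generated by the regular sequence `u, v`. -/
structure RegularSystem (ν : AddValuation K (WithTop ℚ)) (A : Subalgebra k K) (u v : K) :
    Prop where
  noetherian : IsNoetherianRing A
  nonneg : ∀ a ∈ A, 0 ≤ ν a
  inv_mem : ∀ a ∈ A, ν a = 0 → a⁻¹ ∈ A
  left_mem : u ∈ A
  right_mem : v ∈ A
  left_pos : 0 < ν u
  right_pos : 0 < ν v
  left_ne : u ≠ 0
  span : ∀ a ∈ A, 0 < ν a → ∃ b ∈ A, ∃ c ∈ A, a = b * u + c * v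
  regular : ∀ a ∈ A, ∀ b ∈ A, a * v = b * u → ∃ c ∈ A, a = c * u

theorem AddValuation.ne_zero_of_eq_zero (ν : AddValuation K (WithTop ℚ)) {a : K} (ha : ν a = 0) :
    a ≠ 0 := (AddValuation.val_inv_of_eq_zero ν ha).1

theorem AddValuation.pos_mul_left (ν : AddValuation K (WithTop ℚ)) {a b : K} (ha : 0 ≤ ν a)
    (hb : 0 < ν b) : 0 < ν (a * b) := by
  rw [AddValuation.map_mul, add_comm]
  exact add_pos_of_pos_of_nonneg hb ha

namespace RegularSystem

variable {ν : AddValuation K (WithTop ℚ)} {A : Subalgebra k K} {u v : K}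

theorem isUnit_iff (h : RegularSystem ν A u v) {a : A} : IsUnit a ↔ ν (a : K) = 0 := by
  constructor
  · rintro ⟨e, rfl⟩
    have h1 : ν ((e : A) : K) + ν ((e⁻¹ : Aˣ) : A) = 0 := by
      rw [← AddValuation.map_mul, ← Subalgebra.coe_mul, Units.mul_inv]
      simp
    exact le_antisymm (h1 ▸ le_add_of_nonneg_right (h.nonneg _ (Subtype.coe_prop _)))
      (h.nonneg _ (Subtype.coe_prop _))
  · intro ha
    refine IsUnit.of_mul_eq_one ⟨(a : K)⁻¹, h.inv_mem _ a.2 ha⟩ (Subtype.ext ?_)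
    exact mul_inv_cancel₀ (ν.ne_zero_of_eq_zero ha)

theorem mem_nonunits (h : RegularSystem ν A u v) {a : A} : a ∈ nonunits A ↔ 0 < ν (a : K) := by
  rw [mem_nonunits_iff, h.isUnit_iff, (h.nonneg _ a.2).lt_iff_ne']

theorem isLocalRing (h : RegularSystem ν A u v) : IsLocalRing A := by
  refine IsLocalRing.of_nonunits_add fun {a b} ha hb => ?_
  rw [h.mem_nonunits] at *
  exact AddValuation.map_lt_add ν ha hb

theorem isDominated (h : RegularSystem ν A u v) : IsDominated ν A :=
  ⟨fun a => h.nonneg _ a.2, fun _ ha => h.mem_nonunits.mp ha⟩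

theorem maximalIdeal_eq (h : RegularSystem ν A u v) [IsLocalRing A] :
    maximalIdeal A = Ideal.span {⟨u, h.left_mem⟩, ⟨v, h.right_mem⟩} := by
  ext a
  rw [mem_maximalIdeal, h.mem_nonunits, Ideal.mem_span_pair]
  constructor
  · intro ha
    obtain ⟨b, hb, c, hc, hbc⟩ := h.span _ a.2 ha
    exact ⟨⟨b, hb⟩, ⟨c, hc⟩, Subtype.ext hbc.symm⟩
  · rintro ⟨b, c, rfl⟩
    exact AddValuation.map_lt_add ν (ν.pos_mul_left (h.nonneg _ b.2) h.left_pos)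
      (ν.pos_mul_left (h.nonneg _ c.2) h.right_pos)

theorem not_mul_eq (h : RegularSystem ν A u v) {c : K} (hc : c ∈ A) : c * u ≠ 1 := by
  intro hcu
  have := ν.pos_mul_left (h.nonneg c hc) h.left_pos
  simp [hcu] at this

/-- Regularity of the sequence cancels one factor `v` at a time, down to `u` dividing `1`. -/
theorem not_dvd_pow (h : RegularSystem ν A u v) (n : ℕ) :
    ¬ (⟨u, h.left_mem⟩ : A) ∣ ⟨v, h.right_mem⟩ ^ n := by
  induction n with
  | zero =>
    rintro ⟨c, hc⟩
    apply h.not_mul_eq c.2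
    simpa [mul_comm] using (congrArg Subtype.val hc).symm
  | succ n ih =>
    rintro ⟨b, hb⟩
    obtain ⟨c, hc, hcn⟩ := h.regular (v ^ n) (A.pow_mem h.right_mem n) b b.2 (by
      rw [← pow_succ, mul_comm]
      exact congrArg Subtype.val hb)
    exact ih ⟨⟨c, hc⟩, Subtype.ext (by simpa [mul_comm] using hcn)⟩

theorem not_dvd (h : RegularSystem ν A u v) :
    ¬ (⟨u, h.left_mem⟩ : A) ∣ ⟨v, h.right_mem⟩ := by
  simpa using h.not_dvd_pow 1

theorem right_ne (h : RegularSystem ν A u v) : v ≠ 0 := fun h0 =>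
  h.not_dvd ⟨0, Subtype.ext (by simp [h0])⟩

theorem swap (h : RegularSystem ν A u v) : RegularSystem ν A v u where
  noetherian := h.noetherian
  nonneg := h.nonneg
  inv_mem := h.inv_mem
  left_mem := h.right_mem
  right_mem := h.left_mem
  left_pos := h.right_pos
  right_pos := h.left_pos
  left_ne := h.right_ne
  span := fun a ha hpos => by
    obtain ⟨b, hb, c, hc, hbc⟩ := h.span a ha hpos
    exact ⟨c, hc, b, hb, by rw [hbc, add_comm]⟩
  regular := fun a ha b hb hab => by
    obtain ⟨c, hc, rfl⟩ := h.regular b hb a ha hab.symm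
    refine ⟨c, hc, mul_right_cancel₀ h.left_ne ?_⟩
    rw [hab]
    ring

theorem prime_left (h : RegularSystem ν A u v) : Prime (⟨u, h.left_mem⟩ : A) := by
  have := h.isLocalRing
  have := h.noetherian
  exact prime_of_maximalIdeal_eq_span_pair h.maximalIdeal_eq
    (fun h0 => h.left_ne (congrArg Subtype.val h0)) h.not_dvd_pow

theorem isRegularParameters (h : RegularSystem ν A u v) :
    IsRegularParameters (⟨u, h.left_mem⟩ : A) ⟨v, h.right_mem⟩ := by
  have := h.isLocalRing
  have := h.noetherian
  have hdim := ringKrullDim_eq_two h.maximalIdeal_eq h.prime_left h.not_dvd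
  refine ⟨isRegularLocalRing_of_span_pair h.maximalIdeal_eq hdim, hdim, ?_⟩
  rw [← h.maximalIdeal_eq]
  rfl

/-- Dimension two prevents `x` from dividing a power of `y`, so `x` is prime, and primality yields
the regular sequence. -/
theorem of_isRegularParameters {x y : A} (hA : IsDominated ν A) (h : IsRegularParameters x y) :
    RegularSystem ν A x y := by
  have := h.regular
  have hm : maximalIdeal A = Ideal.span {x, y} := SetLike.coe_injective h.span.symm
  have hx : x ∈ nonunits A := by
    rw [← h.span]
    exact Ideal.subset_span (by simp)
  have hy : y ∈ nonunits A := by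
    rw [← h.span]
    exact Ideal.subset_span (by simp)
  have hndvd := not_dvd_pow_of_ringKrullDim_eq_two hm h.dim
  have hx0 : x ≠ 0 := by
    rintro rfl
    -- With the roles exchanged, `x = 0` would be a first power not divisible by `y`, which is
    -- absurd.
    have hndvd' := not_dvd_pow_of_ringKrullDim_eq_two (u := y) (v := 0)
      (by rw [hm, Set.pair_comm]) h.dim 1
    simp at hndvd'
  have hprime := prime_of_maximalIdeal_eq_span_pair hm hx0 hndvd
  refine ⟨inferInstance, fun a ha => hA.1 ⟨a, ha⟩, fun a ha h0 => ?_, x.2, y.2, hA.2 _ hx,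
    hA.2 _ hy, fun h0 => hx0 (Subtype.ext h0), fun a ha hpos => ?_, fun a ha b hb hab => ?_⟩
  · have hu : IsUnit (⟨a, ha⟩ : A) := by
      by_contra hcon
      exact (hA.2 _ hcon).ne' h0
    obtain ⟨c, hc⟩ := hu.exists_right_inv
    rw [inv_eq_of_mul_eq_one_right (congrArg Subtype.val hc)]
    exact c.2
  · have hmem : (⟨a, ha⟩ : A) ∈ Ideal.span {x, y} := by
      rw [← hm, mem_maximalIdeal, mem_nonunits_iff]
      intro hu
      obtain ⟨c, hc⟩ := hu.exists_right_inv
      have h1 : 0 < ν (c * a : K) := ν.pos_mul_left (hA.1 c) hpos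
      rw [mul_comm, show a * (c : K) = 1 from congrArg Subtype.val hc] at h1
      simp at h1
    obtain ⟨b, c, hbc⟩ := Ideal.mem_span_pair.mp hmem
    exact ⟨b, b.2, c, c.2, (congrArg Subtype.val hbc).symm⟩
  · have hd : x ∣ ⟨a, ha⟩ * y := ⟨⟨b, hb⟩, Subtype.ext (by simpa [mul_comm] using hab)⟩
    obtain ⟨c, hc⟩ := (hprime.dvd_or_dvd hd).resolve_right (by simpa using hndvd 1)
    exact ⟨c, c.2, by rw [mul_comm]; exact congrArg Subtype.val hc⟩

theorem change_right (h : RegularSystem ν A u v) {e r : K} (he : e ∈ A) (he0 : ν e = 0)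
    (hr : r ∈ A) : RegularSystem ν A u (e * v + r * u) where
  noetherian := h.noetherian
  nonneg := h.nonneg
  inv_mem := h.inv_mem
  left_mem := h.left_mem
  right_mem := A.add_mem (A.mul_mem he h.right_mem) (A.mul_mem hr h.left_mem)
  left_pos := h.left_pos
  right_pos := AddValuation.map_lt_add ν (ν.pos_mul_left he0.ge h.right_pos)
    (ν.pos_mul_left (h.nonneg r hr) h.left_pos)
  left_ne := h.left_ne
  span := fun a ha hpos => by
    obtain ⟨b, hb, c, hc, hbc⟩ := h.span a ha hpos
    have hce := A.mul_mem hc (h.inv_mem e he he0)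
    refine ⟨b - c * e⁻¹ * r, A.sub_mem hb (A.mul_mem hce hr), c * e⁻¹, hce, ?_⟩
    have := ν.ne_zero_of_eq_zero he0
    rw [hbc]
    field_simp
    ring
  regular := fun a ha b hb hab => by
    have hei := h.inv_mem e he he0
    obtain ⟨c, hc, hac⟩ := h.regular (a * e) (A.mul_mem ha he) (b - a * r)
      (A.sub_mem hb (A.mul_mem ha hr)) (by linear_combination hab)
    refine ⟨e⁻¹ * c, A.mul_mem hei hc, ?_⟩
    have := ν.ne_zero_of_eq_zero he0
    field_simp
    linear_combination hac

end RegularSystem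

end RegularSystems

/-! ### Affine charts of the blowing up and their localizations. -/

section BlowUps

open IsLocalRing Polynomial

variable {k K : Type*} [Field k] [Field K] [Algebra k K]

theorem le_localizationAlong (ν : AddValuation K (WithTop ℚ)) (A : Subalgebra k K) :
    A ≤ localizationAlong ν A :=
  fun a ha => ⟨a, ha, 1, A.one_mem, AddValuation.map_one ν, by simp⟩

theorem AddValuation.map_div_of_eq_zero (ν : AddValuation K (WithTop ℚ)) (a : K) {b : K}
    (hb : ν b = 0) : ν (a / b) = ν a := by
  rw [div_eq_mul_inv, AddValuation.map_mul, (AddValuation.val_inv_of_eq_zero ν hb).2, add_zero]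

theorem inv_mem_localizationAlong {ν : AddValuation K (WithTop ℚ)} {A : Subalgebra k K} {f : K}
    (hf : f ∈ localizationAlong ν A) (h0 : ν f = 0) : f⁻¹ ∈ localizationAlong ν A := by
  obtain ⟨a, ha, b, hb, hν, rfl⟩ := hf
  rw [ν.map_div_of_eq_zero _ hν] at h0
  exact ⟨b, hb, a, ha, h0, by rw [inv_div]⟩

theorem localizationAlong_le {ν : AddValuation K (WithTop ℚ)} {A B : Subalgebra k K}
    (h : A ≤ localizationAlong ν B) : localizationAlong ν A ≤ localizationAlong ν B := by
  rintro _ ⟨a, ha, b, hb, hν, rfl⟩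
  rw [div_eq_mul_inv]
  exact Subalgebra.mul_mem _ (h ha) (inv_mem_localizationAlong (h hb) hν)

theorem isNoetherianRing_localizationAlong (ν : AddValuation K (WithTop ℚ)) (A : Subalgebra k K)
    [IsNoetherianRing A] : IsNoetherianRing (localizationAlong ν A) := by
  let M : Submonoid A :=
    { carrier := {a | ν (a : K) = 0}
      one_mem' := AddValuation.map_one ν
      mul_mem' := fun {a b} ha hb => by
        simp only [Set.mem_ofPred_eq] at *
        rw [Subalgebra.coe_mul, AddValuation.map_mul, ha, hb, add_zero] }
  let _ : Algebra A (localizationAlong ν A) :=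
    (Subalgebra.inclusion (le_localizationAlong ν A)).toRingHom.toAlgebra
  have hval : ∀ a : A, (algebraMap A (localizationAlong ν A) a : K) = a := fun a => rfl
  have : IsLocalization M (localizationAlong ν A) := by
    refine ⟨?_, ?_, ?_⟩
    · rintro ⟨a, ha⟩
      have ha' : ν (a : K) = 0 := ha
      refine IsUnit.of_mul_eq_one
        ⟨(a : K)⁻¹, inv_mem_localizationAlong (le_localizationAlong ν A a.2) ha'⟩ (Subtype.ext ?_)
      exact mul_inv_cancel₀ (ν.ne_zero_of_eq_zero ha')
    · rintro ⟨_, a, ha, b, hb, hν, rfl⟩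
      refine ⟨⟨⟨a, ha⟩, ⟨⟨b, hb⟩, hν⟩⟩, Subtype.ext ?_⟩
      exact div_mul_cancel₀ a (ν.ne_zero_of_eq_zero hν)
    · intro a b hab
      rw [Subtype.ext ((hval a).symm.trans ((congrArg Subtype.val hab).trans (hval b)))]
      exact ⟨1, rfl⟩
  exact IsLocalization.isNoetherianRing M _ inferInstance

/-- The affine chart `A[m / z]` of the blowing up of the maximal ideal `m` of `A`. -/
def blowUpChart (A : Subalgebra k K) (z : K) : Subalgebra k K :=
  Algebra.adjoin k ((A : Set K) ∪ {f | ∃ w ∈ nonunits A, f = (w : K) / z})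

/-- Two elements `z`, `z'` of minimal value have a quotient of value zero, hence a unit after
localization, and `w / z = (w / z') / (z / z')`. -/
theorem IsQuadraticTransform.eq {ν : AddValuation K (WithTop ℚ)} {A B C : Subalgebra k K}
    (hB : IsQuadraticTransform ν A B) (hC : IsQuadraticTransform ν A C) : B = C := by
  have key : ∀ {z z' : A}, z ∈ nonunits A → z ≠ 0 → z' ≠ 0 → ν (z : K) = ν (z' : K) →
      localizationAlong ν (blowUpChart A z) ≤ localizationAlong ν (blowUpChart A z') := by
    intro z z' hz h0 h0' heq
    have hz0 : (z : K) ≠ 0 := fun h => h0 (Subtype.ext h)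
    have hz0' : (z' : K) ≠ 0 := fun h => h0' (Subtype.ext h)
    refine localizationAlong_le (Algebra.adjoin_le ?_)
    rintro f (hf | ⟨w, hw, rfl⟩)
    · exact le_localizationAlong _ _ (Algebra.subset_adjoin (Or.inl hf))
    · refine ⟨w / z', Algebra.subset_adjoin (Or.inr ⟨w, hw, rfl⟩), z / z',
        Algebra.subset_adjoin (Or.inr ⟨z, hz, rfl⟩), ?_, ?_⟩
      · have hne : ν (z' : K) ≠ ⊤ := by rwa [Ne, AddValuation.top_iff]
        have : ν (z / z' : K) + ν (z' : K) = 0 + ν (z' : K) := by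
          rw [← AddValuation.map_mul, div_mul_cancel₀ _ hz0', heq, zero_add]
        exact WithTop.add_right_cancel hne this
      · field_simp
  obtain ⟨z, hz, h0, hmin, rfl⟩ := hB
  obtain ⟨z', hz', h0', hmin', rfl⟩ := hC
  have heq := le_antisymm (hmin z' hz') (hmin' z hz)
  exact le_antisymm (key hz h0 h0' heq) (key hz' h0' h0 heq.symm)

namespace RegularSystem

variable {ν : AddValuation K (WithTop ℚ)} {A : Subalgebra k K} {u v : K}

/-- Since `u` and `v` generate the maximal ideal, the chart is `A[v / u]`, so its elements can be
handled as polynomials. -/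
theorem mem_blowUpChart (h : RegularSystem ν A u v) {f : K} :
    f ∈ blowUpChart A u ↔ ∃ F : A[X], aeval (v / u) F = f := by
  have hu := h.left_ne
  have hadj : v / u ∈ blowUpChart A u :=
    Algebra.subset_adjoin (Or.inr ⟨⟨v, h.right_mem⟩, h.mem_nonunits.mpr h.right_pos, rfl⟩)
  constructor
  · intro hf
    let C : Subalgebra k K := (aeval (v / u) : A[X] →ₐ[A] K).range.restrictScalars k
    have hle : blowUpChart A u ≤ C := by
      refine Algebra.adjoin_le ?_
      rintro g (hg | ⟨w, hw, rfl⟩)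
      · exact ⟨Polynomial.C ⟨g, hg⟩, aeval_C _ _⟩
      · obtain ⟨b, hb, c, hc, hbc⟩ := h.span w w.2 (h.mem_nonunits.mp hw)
        refine ⟨Polynomial.C ⟨b, hb⟩ + Polynomial.C ⟨c, hc⟩ * X, ?_⟩
        have : b + c * (v / u) = (w : K) / u := by
          rw [hbc]
          field_simp
        simpa using this
    exact hle hf
  · rintro ⟨F, rfl⟩
    rw [aeval_eq_sum_range]
    refine Subalgebra.sum_mem _ fun i _ => ?_
    rw [Algebra.smul_def]
    exact Subalgebra.mul_mem _ (Algebra.subset_adjoin (Or.inl (F.coeff i).2))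
      (Subalgebra.pow_mem _ hadj i)

theorem isNoetherianRing_blowUpChart (h : RegularSystem ν A u v) :
    IsNoetherianRing (blowUpChart A u) := by
  have := h.noetherian
  let φ : A[X] →+* blowUpChart A u :=
    (aeval (v / u) : A[X] →ₐ[A] K).toRingHom.codRestrict (blowUpChart A u)
      fun F => h.mem_blowUpChart.mpr ⟨F, rfl⟩
  refine isNoetherianRing_of_surjective _ _ φ ?_
  rintro ⟨f, hf⟩
  obtain ⟨F, rfl⟩ := h.mem_blowUpChart.mp hf
  exact ⟨F, rfl⟩

/-- Multiplying the relation by `u ^ n` leaves one term without a factor `u`, namely the top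
coefficient times `v ^ n`; then use that `u` is prime. -/
theorem dvd_coeff_of_aeval_eq_zero (h : RegularSystem ν A u v) {F : A[X]} {n : ℕ}
    (hF : F.natDegree ≤ n) (h0 : aeval (v / u) F = 0) :
    (⟨u, h.left_mem⟩ : A) ∣ F.coeff n := by
  have hu := h.left_ne
  have hsum : F.coeff n * ⟨v, h.right_mem⟩ ^ n +
      ∑ i ∈ Finset.range n,
        F.coeff i * ⟨u, h.left_mem⟩ ^ (n - i) * (⟨v, h.right_mem⟩ : A) ^ i = 0 := by
    apply Subtype.ext
    rw [aeval_eq_sum_range' (Nat.lt_succ_of_le hF), Finset.sum_range_succ] at h0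
    have h1 := congrArg (u ^ n * ·) h0
    simp only [mul_zero, mul_add, Finset.mul_sum] at h1
    simp only [Subalgebra.coe_add, Subalgebra.coe_mul, Subalgebra.coe_pow, Subalgebra.coe_zero,
      AddSubmonoidClass.coe_finsetSum]
    rw [← h1, add_comm]
    congr 1
    · refine Finset.sum_congr rfl fun i hi => ?_
      have hn : n = n - i + i := by have := Finset.mem_range.mp hi; omega
      rw [Algebra.smul_def, show algebraMap A K (F.coeff i) = F.coeff i from rfl]
      conv_rhs => rw [hn, pow_add, div_pow]
      field_simp
    · rw [Algebra.smul_def, show algebraMap A K (F.coeff n) = F.coeff n from rfl, div_pow]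
      field_simp
  have hd : (⟨u, h.left_mem⟩ : A) ∣ F.coeff n * ⟨v, h.right_mem⟩ ^ n := by
    rw [eq_neg_of_add_eq_zero_left hsum]
    refine (Finset.dvd_sum fun i hi => ?_).neg_right
    rw [mul_assoc]
    refine ((dvd_pow_self _ ?_).mul_right _).mul_left _
    have := Finset.mem_range.mp hi
    omega
  exact (h.prime_left.dvd_or_dvd hd).resolve_right (h.not_dvd_pow n)

/-- This says that `v / u` is transcendental modulo the maximal ideal: the exceptional fibre of the
chart is an affine line. -/
theorem coeff_pos_of_aeval_eq_zero (h : RegularSystem ν A u v) (n : ℕ) :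
    ∀ F : A[X], F.natDegree ≤ n → aeval (v / u) F = 0 → ∀ i, 0 < ν (F.coeff i : K) := by
  have hdvd : ∀ {a : A}, (⟨u, h.left_mem⟩ : A) ∣ a → 0 < ν (a : K) := by
    rintro _ ⟨c, rfl⟩
    rw [mul_comm]
    exact ν.pos_mul_left (h.nonneg c c.2) h.left_pos
  induction n with
  | zero =>
    intro F hF h0 i
    rcases i with _ | i
    · exact hdvd (h.dvd_coeff_of_aeval_eq_zero hF h0)
    · rw [coeff_eq_zero_of_natDegree_lt (by omega)]
      simp
  | succ n ih =>
    intro F hF h0 i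
    obtain ⟨c, hc⟩ := h.dvd_coeff_of_aeval_eq_zero hF h0
    -- The leading coefficient is `u * c`, and at `v / u` the term `u c X^(n+1)` takes the same
    -- value as `c v X^n`. The trade lowers the degree bound and alters the remaining coefficients
    -- only by `c v`, of positive value.
    set G : A[X] := F - C (F.coeff (n + 1)) * X ^ (n + 1) + C (c * ⟨v, h.right_mem⟩) * X ^ n
      with hG
    have hcoeff : ∀ j, G.coeff j = F.coeff j - (if j = n + 1 then F.coeff (n + 1) else 0) +
        if j = n then c * ⟨v, h.right_mem⟩ else 0 := fun j => by
      simp only [hG, coeff_add, coeff_sub, coeff_C_mul, coeff_X_pow, mul_ite, mul_one, mul_zero]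
    have hGd : G.natDegree ≤ n := by
      rw [natDegree_le_iff_coeff_eq_zero]
      intro j hj
      rw [hcoeff, if_neg hj.ne', add_zero]
      split_ifs with hjn
      · rw [hjn, sub_self]
      · rw [sub_zero]
        exact coeff_eq_zero_of_natDegree_lt (by omega)
    have hG0 : aeval (v / u) G = 0 := by
      have hu := h.left_ne
      simp only [hG, map_add, map_sub, h0, map_mul, aeval_C, map_pow, aeval_X, hc]
      change (0 : K) - u * (c : K) * (v / u) ^ (n + 1) + (c : K) * v * (v / u) ^ n = 0
      rw [div_pow, div_pow]
      field_simp
      ring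
    have hpos := ih G hGd hG0 i
    rw [hcoeff] at hpos
    by_cases hi : i = n + 1
    · rw [hi]
      exact hdvd ⟨c, hc⟩
    · rw [if_neg hi, sub_zero] at hpos
      by_cases hin : i = n
      · rw [if_pos hin] at hpos
        have hcv : 0 < ν (c * v) := ν.pos_mul_left (h.nonneg c c.2) h.right_pos
        have := AddValuation.map_lt_add ν hpos ((AddValuation.map_neg ν _).symm ▸ hcv)
        simpa using this
      · simpa [hin] using hpos

end RegularSystem

end BlowUps

/-! ### Regular systems under one quadratic transform and its iterates. -/

section QuadraticTransformsOfRegularSystems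

open IsLocalRing Polynomial

variable {k K : Type*} [Field k] [Field K] [Algebra k K]

theorem AddValuation.ne_top_of_ne_zero (ν : AddValuation K (WithTop ℚ)) {a : K} (ha : a ≠ 0) :
    ν a ≠ ⊤ := by
  rwa [Ne, AddValuation.top_iff]

theorem AddValuation.map_div_add (ν : AddValuation K (WithTop ℚ)) (a : K) {b : K} (hb : b ≠ 0) :
    ν (a / b) + ν b = ν a := by
  rw [← AddValuation.map_mul, div_mul_cancel₀ _ hb]

theorem AddValuation.map_div_pos (ν : AddValuation K (WithTop ℚ)) {a b : K} (hb : b ≠ 0)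
    (h : ν b < ν a) : 0 < ν (a / b) := by
  by_contra! hcon
  have h1 := ν.map_div_add a hb
  have h2 : ν (a / b) + ν b ≤ 0 + ν b := add_le_add_left hcon _
  rw [h1, zero_add] at h2
  exact absurd h h2.not_gt

theorem AddValuation.map_div_eq_zero (ν : AddValuation K (WithTop ℚ)) {a b : K} (hb : b ≠ 0)
    (h : ν a = ν b) : ν (a / b) = 0 := by
  have h1 := ν.map_div_add a hb
  rw [h] at h1
  exact WithTop.add_right_cancel (ν.ne_top_of_ne_zero hb) (h1.trans (zero_add _).symm)

namespace RegularSystem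

variable {ν : AddValuation K (WithTop ℚ)} {A : Subalgebra k K} {u v : K}

theorem isQuadraticTransform (h : RegularSystem ν A u v) (hlt : ν u ≤ ν v) :
    IsQuadraticTransform ν A (localizationAlong ν (blowUpChart A u)) := by
  refine ⟨⟨u, h.left_mem⟩, h.mem_nonunits.mpr h.left_pos,
    fun h0 => h.left_ne (congrArg Subtype.val h0), fun w hw => ?_, rfl⟩
  obtain ⟨b, hb, c, hc, hbc⟩ := h.span w w.2 (h.mem_nonunits.mp hw)
  have hmul : ∀ {a f : K}, a ∈ A → ν u ≤ ν f → ν u ≤ ν (a * f) := fun ha hf => by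
    rw [AddValuation.map_mul]
    exact hf.trans (le_add_of_nonneg_left (h.nonneg _ ha))
  rw [hbc]
  exact AddValuation.map_le_add ν (hmul hb le_rfl) (hmul hc hlt)

/-- The center on the chart `A[v / u]` is generated by `u` and `v / u`: split a polynomial in `v /
u` into its constant term and the rest. These form a regular sequence because relations among powers
of `v / u` have coefficients in the maximal ideal. -/
theorem blowUp (h : RegularSystem ν A u v) (hlt : ν u < ν v) :
    RegularSystem ν (localizationAlong ν (blowUpChart A u)) u (v / u) := by
  have hu := h.left_ne
  have hpos : 0 < ν (v / u) := ν.map_div_pos hu hlt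
  have hle := le_localizationAlong ν (blowUpChart A u)
  have hA : A ≤ blowUpChart A u := fun a ha => Algebra.subset_adjoin (Or.inl ha)
  have ht : v / u ∈ blowUpChart A u := h.mem_blowUpChart.mpr ⟨X, aeval_X _⟩
  have hnn : ∀ f ∈ blowUpChart A u, 0 ≤ ν f := by
    intro f hf
    obtain ⟨F, rfl⟩ := h.mem_blowUpChart.mp hf
    rw [aeval_eq_sum_range]
    refine AddValuation.map_le_sum ν fun i _ => ?_
    rw [Algebra.smul_def, AddValuation.map_mul, AddValuation.map_pow]
    exact add_nonneg (h.nonneg _ (F.coeff i).2) (nsmul_nonneg hpos.le i)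
  have hsmall : ∀ a ∈ A, 0 < ν a → ∃ f ∈ blowUpChart A u, a = f * u := by
    intro a ha ha0
    obtain ⟨b, hb, c, hc, rfl⟩ := h.span a ha ha0
    refine ⟨b + c * (v / u), Subalgebra.add_mem _ (hA hb) (Subalgebra.mul_mem _ (hA hc) ht), ?_⟩
    field_simp
  have hchart : ∀ a ∈ blowUpChart A u, ∀ b ∈ blowUpChart A u, a * (v / u) = b * u →
      ∃ f ∈ blowUpChart A u, a = f * u := by
    intro a ha b hb hab
    obtain ⟨F, rfl⟩ := h.mem_blowUpChart.mp ha
    obtain ⟨G, rfl⟩ := h.mem_blowUpChart.mp hb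
    -- The coefficients of this relation have positive value, hence so do those of `F`; each of them
    -- is then `u` times an element of the chart.
    have h0 : aeval (v / u) (F * X - G * C ⟨u, h.left_mem⟩) = 0 := by
      simp only [map_sub, map_mul, aeval_X, aeval_C, hab]
      exact sub_self _
    have hF : ∀ i, 0 < ν (F.coeff i : K) := by
      intro i
      have h1 := h.coeff_pos_of_aeval_eq_zero _ _ le_rfl h0 (i + 1)
      rw [coeff_sub, coeff_mul_X, coeff_mul_C] at h1
      have h2 : 0 < ν ((G.coeff (i + 1) : K) * u) :=
        ν.pos_mul_left (h.nonneg _ (G.coeff (i + 1)).2) h.left_pos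
      have h3 := AddValuation.map_lt_add ν h1 h2
      simpa using h3
    choose f hf hfu using fun i => hsmall _ (F.coeff i).2 (hF i)
    refine ⟨∑ i ∈ Finset.range (F.natDegree + 1), f i * (v / u) ^ i,
      Subalgebra.sum_mem _ fun i _ => Subalgebra.mul_mem _ (hf i) (Subalgebra.pow_mem _ ht i), ?_⟩
    rw [aeval_eq_sum_range, Finset.sum_mul]
    refine Finset.sum_congr rfl fun i _ => ?_
    rw [Algebra.smul_def, show algebraMap A K (F.coeff i) = F.coeff i from rfl, hfu i]
    ring
  have hdiv : ∀ {f b : K}, f ∈ blowUpChart A u → b ∈ blowUpChart A u → ν b = 0 →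
      f / b ∈ localizationAlong ν (blowUpChart A u) := fun {f b} hf hb hν => ⟨f, hf, b, hb, hν, rfl⟩
  refine ⟨?_, ?_, fun a => inv_mem_localizationAlong, hle (hA h.left_mem), hle ht, h.left_pos,
    hpos, hu, ?_, ?_⟩
  · have := h.isNoetherianRing_blowUpChart
    exact isNoetherianRing_localizationAlong ν _
  · rintro _ ⟨a, ha, b, hb, hν, rfl⟩
    rw [ν.map_div_of_eq_zero _ hν]
    exact hnn a ha
  · rintro _ ⟨a, ha, b, hb, hν, rfl⟩ ha0
    rw [ν.map_div_of_eq_zero _ hν] at ha0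
    obtain ⟨F, rfl⟩ := h.mem_blowUpChart.mp ha
    have hF : (aeval (v / u)) F = (aeval (v / u)) F.divX * (v / u) + (F.coeff 0 : K) := by
      conv_lhs => rw [← divX_mul_X_add F]
      simp only [map_add, map_mul, aeval_X, aeval_C]
      rfl
    have hdX := h.mem_blowUpChart.mpr ⟨F.divX, rfl⟩
    have hc0 : 0 < ν (F.coeff 0 : K) := by
      have h1 := AddValuation.map_lt_add ν ha0
        ((AddValuation.map_neg ν _).symm ▸ ν.pos_mul_left (hnn _ hdX) hpos)
      rw [hF] at h1
      simpa using h1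
    obtain ⟨f, hf, hfu⟩ := hsmall _ (F.coeff 0).2 hc0
    refine ⟨_, hdiv hf hb hν, _, hdiv hdX hb hν, ?_⟩
    rw [hF, hfu]
    ring
  · rintro _ ⟨a, ha, b, hb, hν, rfl⟩ _ ⟨a', ha', b', hb', hν', rfl⟩ hab
    have hb0 := ν.ne_zero_of_eq_zero hν
    have hb0' := ν.ne_zero_of_eq_zero hν'
    obtain ⟨f, hf, hfu⟩ := hchart (a * b') (Subalgebra.mul_mem _ ha hb') (a' * b)
      (Subalgebra.mul_mem _ ha' hb) (by
        field_simp at hab ⊢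
        linear_combination hab)
    refine ⟨f / (b * b'), hdiv hf (Subalgebra.mul_mem _ hb hb')
      (by rw [AddValuation.map_mul, hν, hν', add_zero]), ?_⟩
    field_simp
    linear_combination hfu

end RegularSystem

open Classical in
/-- The quadratic transform of `A` along `ν`, and `A` itself if there is none. -/
noncomputable def quadraticTransform (ν : AddValuation K (WithTop ℚ)) (A : Subalgebra k K) :
    Subalgebra k K :=
  if h : ∃ B, IsQuadraticTransform ν A B then h.choose else A

theorem IsQuadraticTransform.quadraticTransform_eq {ν : AddValuation K (WithTop ℚ)}
    {A B : Subalgebra k K} (h : IsQuadraticTransform ν A B) : quadraticTransform ν A = B := by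
  have hex : ∃ B, IsQuadraticTransform ν A B := ⟨B, h⟩
  rw [quadraticTransform, dif_pos hex]
  exact hex.choose_spec.eq h

namespace RegularSystem

variable {ν : AddValuation K (WithTop ℚ)} {A : Subalgebra k K} {u v : K}

theorem isQuadraticTransform_quadraticTransform (h : RegularSystem ν A u v) :
    IsQuadraticTransform ν A (quadraticTransform ν A) := by
  rcases le_total (ν u) (ν v) with hle | hle
  · rw [(h.isQuadraticTransform hle).quadraticTransform_eq]
    exact h.isQuadraticTransform hle
  · rw [(h.swap.isQuadraticTransform hle).quadraticTransform_eq]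
    exact h.swap.isQuadraticTransform hle

theorem quadraticTransform_of_lt (h : RegularSystem ν A u v) (hlt : ν u < ν v) :
    RegularSystem ν (quadraticTransform ν A) u (v / u) := by
  rw [(h.isQuadraticTransform hlt.le).quadraticTransform_eq]
  exact h.blowUp hlt

theorem quadraticTransform_of_eq (h : RegularSystem ν A u v) {c : k}
    (hc : IsResidue ν (v / u) c) :
    RegularSystem ν (quadraticTransform ν A) u (v / u - algebraMap k K c) := by
  have hu := h.left_ne
  have h1 := h.change_right A.one_mem (AddValuation.map_one ν)
    (A.neg_mem (A.algebraMap_mem c))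
  -- Replacing `v` by `v - c u` keeps a regular system and strictly raises the value above that of
  -- `u`, which reduces to the previous case.
  have heq : (1 * v + -algebraMap k K c * u) = (v / u - algebraMap k K c) * u := by
    field_simp
    ring
  rw [heq] at h1
  have hlt : ν u < ν ((v / u - algebraMap k K c) * u) := by
    rw [AddValuation.map_mul]
    obtain ⟨r, hr⟩ := WithTop.ne_top_iff_exists.mp (ν.ne_top_of_ne_zero hu)
    have hpos : 0 < ν (v / u - algebraMap k K c) := hc
    rw [← hr]
    cases hs : ν (v / u - algebraMap k K c) with
    | top => simp
    | coe s =>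
      rw [hs] at hpos
      have hs0 : 0 < s := by exact_mod_cast hpos
      exact_mod_cast lt_add_of_pos_left r hs0
  have h2 := h1.quadraticTransform_of_lt hlt
  rwa [mul_div_cancel_right₀ _ hu] at h2

theorem exists_quadraticTransform (h : RegularSystem ν A u v)
    (hres : ∀ f : K, ν f = 0 → ∃ c : k, IsResidue ν f c) :
    ∃ u' v' : K, RegularSystem ν (quadraticTransform ν A) u' v' := by
  rcases lt_trichotomy (ν u) (ν v) with hlt | heq | hlt
  · exact ⟨_, _, h.quadraticTransform_of_lt hlt⟩
  · obtain ⟨c, hc⟩ := hres _ (ν.map_div_eq_zero h.left_ne heq.symm)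
    exact ⟨_, _, h.quadraticTransform_of_eq hc⟩
  · exact ⟨_, _, h.swap.quadraticTransform_of_lt hlt⟩

theorem isQuadraticSequence (h : RegularSystem ν A u v)
    (hres : ∀ f : K, ν f = 0 → ∃ c : k, IsResidue ν f c) :
    IsQuadraticSequence ν A fun n => (quadraticTransform ν)^[n] A := by
  have hex : ∀ n, ∃ u' v' : K, RegularSystem ν ((quadraticTransform ν)^[n] A) u' v' := by
    intro n
    induction n with
    | zero => exact ⟨u, v, h⟩
    | succ n ih =>
      obtain ⟨u', v', h'⟩ := ih
      rw [Function.iterate_succ_apply']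
      exact h'.exists_quadraticTransform hres
  refine ⟨rfl, fun n => ?_, fun n => ?_, fun n => ?_⟩ <;> obtain ⟨u', v', h'⟩ := hex n
  · simp only [Function.iterate_succ_apply']
    exact h'.isQuadraticTransform_quadraticTransform
  · exact h'.isRegularParameters.regular
  · exact h'.isDominated

theorem le_quadraticTransform (h : RegularSystem ν A u v) : A ≤ quadraticTransform ν A :=
  h.isQuadraticTransform_quadraticTransform.le

end RegularSystem

end QuadraticTransformsOfRegularSystems

/-! ### The Euclidean algorithm on the values of two parameters. -/

section EuclideanAlgorithm

variable {k K : Type*} [Field k] [Field K] [Algebra k K]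

theorem euclidSum_comm (p q : ℕ) : euclidSum p q = euclidSum q p := by
  have key : ∀ {a b : ℕ}, a < b → euclidSum a b = euclidSum b a := by
    intro a b hab
    rw [euclidSum, dif_neg (by omega), Nat.div_eq_of_lt hab, Nat.mod_eq_of_lt hab, zero_add]
  rcases lt_trichotomy p q with h | rfl | h
  · exact key h
  · rfl
  · exact (key h).symm

/-- Each subtraction accounts for one unit of a partial quotient, that is, for one quadratic
transform. -/
theorem euclidSum_of_lt {p q : ℕ} (hq : 0 < q) (h : q < p) :
    euclidSum p q = euclidSum (p - q) q + 1 := by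
  rw [euclidSum, dif_neg hq.ne', euclidSum.eq_1 (p - q), dif_neg hq.ne',
    ← Nat.mod_eq_sub_mod h.le, Nat.div_eq_sub_div hq h.le]
  ring

theorem euclidSum_one_one : euclidSum 1 1 = 1 := by
  simp [euclidSum]

namespace RegularSystem

variable {ν : AddValuation K (WithTop ℚ)}

/-- Subtractive Euclid, by induction on a bound for `p + q`. Replacing the parameter of larger value
by its quotient by the other one subtracts the smaller exponent from the larger and does not change
`v ^ q / u ^ p`. Coprimality makes the descent end at `p = q = 1`, where the last transform
subtracts the residue. -/
theorem exists_iterate_quadraticTransform (n : ℕ) :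
    ∀ {p q : ℕ} (_ : p + q ≤ n) (_ : 0 < p) (_ : 0 < q) (_ : p.Coprime q) {A : Subalgebra k K}
      {u v : K} (_ : RegularSystem ν A u v) {g : ℚ} (_ : ν u = ((q * g : ℚ) : WithTop ℚ))
      (_ : ν v = ((p * g : ℚ) : WithTop ℚ)) {c : k} (_ : IsResidue ν (v ^ q / u ^ p) c),
      A ≤ (quadraticTransform ν)^[euclidSum p q] A ∧
      ∃ w : K, RegularSystem ν ((quadraticTransform ν)^[euclidSum p q] A) w
          (v ^ q / u ^ p - algebraMap k K c) ∧ ν w = (g : WithTop ℚ) ∧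
        (∃ e ∈ (quadraticTransform ν)^[euclidSum p q] A, ν e = 0 ∧ u = w ^ q * e) ∧
        ∃ e ∈ (quadraticTransform ν)^[euclidSum p q] A, ν e = 0 ∧ v = w ^ p * e := by
  have hquot : ∀ {a b : K} {r s : ℚ}, b ≠ 0 → ν a = (r : WithTop ℚ) → ν b = (s : WithTop ℚ) →
      ν (a / b) = ((r - s : ℚ) : WithTop ℚ) := by
    intro a b r s hb ha hb'
    refine WithTop.add_right_cancel (ν.ne_top_of_ne_zero hb) ?_
    rw [ν.map_div_add a hb, ha, hb']
    exact_mod_cast (sub_add_cancel r s).symm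
  induction n with
  | zero =>
    intro p q hn hp
    omega
  | succ n ih =>
    intro p q hn hp hq hpq A u v h g hu hv c hc
    have hu0 := h.left_ne
    have hv0 := h.right_ne
    have hg : 0 < g := by
      have h1 := h.left_pos
      rw [hu] at h1
      have h2 : 0 < q * g := by exact_mod_cast h1
      exact pos_of_mul_pos_right h2 (Nat.cast_nonneg q)
    rcases lt_trichotomy p q with hlt | rfl | hlt
    · have hlt' : ν v < ν u := by
        rw [hu, hv]
        have : (p : ℚ) < q := by exact_mod_cast hlt
        exact_mod_cast mul_lt_mul_of_pos_right this hg
      have h1 := (h.swap.quadraticTransform_of_lt hlt').swap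
      have hval : ν (u / v) = (((q - p : ℕ) * g : ℚ) : WithTop ℚ) := by
        rw [hquot hv0 hu hv, Nat.cast_sub hlt.le, sub_mul]
      have hrat : v ^ q / u ^ p = v ^ (q - p) / (u / v) ^ p := by
        rw [div_pow, div_div_eq_mul_div, ← pow_add, Nat.sub_add_cancel hlt.le]
      rw [hrat] at hc ⊢
      obtain ⟨hle, w, hw, hwg, ⟨e, he, he0, hue⟩, f, hf, hf0, hvf⟩ :=
        ih (by omega) hp (by omega) ((Nat.coprime_sub_self_right hlt.le).mpr hpq) h1 hval hv hc
      have hidx : euclidSum p q = euclidSum p (q - p) + 1 := by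
        rw [euclidSum_comm p q, euclidSum_of_lt hp hlt, euclidSum_comm _ p]
      rw [hidx, Function.iterate_succ_apply]
      refine ⟨h.le_quadraticTransform.trans hle, w, hw, hwg, ⟨e * f, Subalgebra.mul_mem _ he hf,
        by rw [AddValuation.map_mul, he0, hf0, add_zero], ?_⟩, f, hf, hf0, hvf⟩
      calc u = (u / v) * v := (div_mul_cancel₀ u hv0).symm
        _ = (w ^ (q - p) * e) * (w ^ p * f) := by rw [← hue, ← hvf]
        _ = w ^ (q - p) * w ^ p * (e * f) := by ring
        _ = w ^ q * (e * f) := by rw [← pow_add, Nat.sub_add_cancel hlt.le]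
    · obtain rfl : p = 1 := by simpa using hpq
      rw [euclidSum_one_one]
      have hv' : ν (v / u) = 0 := ν.map_div_eq_zero hu0 (hv.trans hu.symm)
      simp only [pow_one] at hc
      have h1 := h.quadraticTransform_of_eq hc
      refine ⟨h.le_quadraticTransform, u, by simpa using h1, by simpa using hu,
        ⟨1, Subalgebra.one_mem _, AddValuation.map_one ν, by simp⟩, v / u, ?_, hv', ?_⟩
      · have := Subalgebra.add_mem _ h1.right_mem (Subalgebra.algebraMap_mem _ c)
        simpa using this
      · field_simp
    · have hlt' : ν u < ν v := by
        rw [hu, hv]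
        have : (q : ℚ) < p := by exact_mod_cast hlt
        exact_mod_cast mul_lt_mul_of_pos_right this hg
      have h1 := h.quadraticTransform_of_lt hlt'
      have hval : ν (v / u) = (((p - q : ℕ) * g : ℚ) : WithTop ℚ) := by
        rw [hquot hu0 hv hu, Nat.cast_sub hlt.le, sub_mul]
      have hrat : v ^ q / u ^ p = (v / u) ^ q / u ^ (p - q) := by
        rw [div_pow, div_div, ← pow_add, Nat.add_sub_cancel' hlt.le]
      rw [hrat] at hc ⊢
      obtain ⟨hle, w, hw, hwg, ⟨e, he, he0, hue⟩, f, hf, hf0, hvf⟩ :=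
        ih (by omega) (by omega) hq ((Nat.coprime_sub_self_left hlt.le).mpr hpq) h1 hu hval hc
      rw [euclidSum_of_lt hq hlt, Function.iterate_succ_apply]
      refine ⟨h.le_quadraticTransform.trans hle, w, hw, hwg, ⟨e, he, he0, hue⟩, f * e,
        Subalgebra.mul_mem _ hf he, by rw [AddValuation.map_mul, he0, hf0, add_zero], ?_⟩
      calc v = (v / u) * u := (div_mul_cancel₀ v hu0).symm
        _ = (w ^ (p - q) * f) * (w ^ q * e) := by rw [← hue, ← hvf]
        _ = w ^ (p - q) * w ^ q * (f * e) := by ring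
        _ = w ^ p * (f * e) := by rw [← pow_add, Nat.sub_add_cancel hlt.le]

/-- The Euclidean algorithm for the values of a regular system of parameters `u, v`, with the new
parameter multiplied by a unit of the original ring. -/
theorem exists_iterate_quadraticTransform_unit_mul {p q : ℕ} (hp : 0 < p) (hq : 0 < q)
    (hpq : p.Coprime q) {A : Subalgebra k K} {u v : K} (h : RegularSystem ν A u v) {g : ℚ}
    (hu : ν u = ((q * g : ℚ) : WithTop ℚ)) (hv : ν v = ((p * g : ℚ) : WithTop ℚ))
    (hres : ∀ f : K, ν f = 0 → ∃ c : k, IsResidue ν f c) {e : K} (he : e ∈ A) (he0 : ν e = 0)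
    {c : k} (hc : IsResidue ν (e * (v ^ q / u ^ p)) c) :
    A ≤ (quadraticTransform ν)^[euclidSum p q] A ∧
    ∃ w : K, RegularSystem ν ((quadraticTransform ν)^[euclidSum p q] A) w
        (e * (v ^ q / u ^ p) - algebraMap k K c) ∧ ν w = (g : WithTop ℚ) ∧
      (∃ f ∈ (quadraticTransform ν)^[euclidSum p q] A, ν f = 0 ∧ u = w ^ q * f) ∧
      ∃ f ∈ (quadraticTransform ν)^[euclidSum p q] A, ν f = 0 ∧ v = w ^ p * f := by
  have hr0 : ν (v ^ q / u ^ p) = 0 := by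
    refine ν.map_div_eq_zero (pow_ne_zero _ h.left_ne) ?_
    rw [AddValuation.map_pow, AddValuation.map_pow, hu, hv, ← WithTop.coe_nsmul,
      ← WithTop.coe_nsmul, nsmul_eq_mul, nsmul_eq_mul]
    congr 1
    ring
  obtain ⟨d, hd⟩ := hres _ hr0
  obtain ⟨hle, w, hw, hwg, ⟨f, hf, hf0, huf⟩, f', hf', hf0', hvf⟩ :=
    exists_iterate_quadraticTransform (p + q) le_rfl hp hq hpq h hu hv hd
  refine ⟨hle, w, ?_, hwg, ⟨f, hf, hf0, huf⟩, f', hf', hf0', hvf⟩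
  set B := (quadraticTransform ν)^[euclidSum p q] A
  -- With `d` the residue of `v ^ q / u ^ p`, the wanted parameter is `e (v ^ q / u ^ p - d) + (e d
  -- - c)`. The second summand is a nonunit of `A`, hence a combination of `u` and `v`, and both are
  -- multiples of `w` because `p` and `q` are positive.
  have hmem : e * algebraMap k K d - algebraMap k K c ∈ A :=
    A.sub_mem (A.mul_mem he (A.algebraMap_mem d)) (A.algebraMap_mem c)
  have hpos : 0 < ν (e * algebraMap k K d - algebraMap k K c) := by
    have h1 : 0 < ν (e * (v ^ q / u ^ p - algebraMap k K d)) := ν.pos_mul_left he0.ge hd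
    have h2 := AddValuation.map_lt_add ν hc ((AddValuation.map_neg ν _).symm ▸ h1)
    convert h2 using 2
    ring
  obtain ⟨b, hb, b', hb', hbb⟩ := h.span _ hmem hpos
  obtain ⟨r, hr, hrw⟩ : ∃ r ∈ B, e * algebraMap k K d - algebraMap k K c = r * w := by
    obtain ⟨p', rfl⟩ := Nat.exists_eq_succ_of_ne_zero hp.ne'
    obtain ⟨q', rfl⟩ := Nat.exists_eq_succ_of_ne_zero hq.ne'
    refine ⟨b * (w ^ q' * f) + b' * (w ^ p' * f'), B.add_mem (B.mul_mem (hle hb)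
      (B.mul_mem (B.pow_mem hw.left_mem _) hf)) (B.mul_mem (hle hb')
      (B.mul_mem (B.pow_mem hw.left_mem _) hf')), ?_⟩
    rw [hbb, huf, hvf, pow_succ, pow_succ]
    ring
  have h3 := hw.change_right (hle he) he0 hr
  rw [← hrw] at h3
  convert h3 using 1
  ring

end RegularSystem

end EuclideanAlgorithm

/-! ### Arithmetic of the jumping values. -/

section JumpingValues

/-- The numerical data of the first `N` jumping polynomials: the values `β`, and coprime pairs
`(p, q)` which determine them. -/
structure IsJumpingValues (β : ℕ → ℚ) (p q : ℕ → ℕ) (N : ℕ) : Prop where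
  zero : β 0 = 1
  p_pos : ∀ i, 0 < i → i ≤ N → 0 < p i
  q_pos : ∀ i, 0 < i → i ≤ N → 0 < q i
  coprime : ∀ i, 0 < i → i ≤ N → (p i).Coprime (q i)
  succ : ∀ i, i + 1 ≤ N → β (i + 1) = (if i = 0 then 0 else q i * β i) +
    1 / (∏ j ∈ Finset.Icc 1 i, (q j : ℚ)) * ((p (i + 1) : ℚ) / q (i + 1))

namespace IsJumpingValues

variable {β : ℕ → ℚ} {p q : ℕ → ℕ} {N : ℕ}

theorem prod_pos (h : IsJumpingValues β p q N) {i : ℕ} (hi : i ≤ N) :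
    0 < ∏ j ∈ Finset.Icc 1 i, (q j : ℚ) :=
  Finset.prod_pos fun j hj => by
    have := Finset.mem_Icc.mp hj
    exact_mod_cast h.q_pos j (by omega) (by omega)

/-- The recursion shows that $Q_i\beta_i$ is an integer congruent to $p_i$ modulo $q_i$. -/
theorem exists_int_eq (h : IsJumpingValues β p q N) {i : ℕ} (hi : i ≤ N) :
    ∃ m : ℤ, (∏ j ∈ Finset.Icc 1 i, (q j : ℚ)) * β i = m ∧ (0 < i → IsCoprime m (q i)) := by
  induction i with
  | zero => exact ⟨1, by simp [h.zero], by simp⟩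
  | succ i ih =>
    obtain ⟨m, hm, -⟩ := ih (by omega)
    have hQ := h.prod_pos (i := i) (by omega)
    have hq : (0 : ℚ) < q (i + 1) := by exact_mod_cast h.q_pos _ (by omega) hi
    have hcop : IsCoprime (p (i + 1) : ℤ) (q (i + 1)) :=
      Nat.isCoprime_iff_coprime.mpr (h.coprime _ (by omega) hi)
    refine ⟨p (i + 1) + q (i + 1) * (if i = 0 then 0 else q i * m), ?_, fun _ =>
      hcop.add_mul_left_left _⟩
    rw [Finset.prod_Icc_succ_top (by omega), h.succ i hi]
    split_ifs with h0
    · push_cast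
      field_simp
      ring
    · push_cast
      rw [← hm]
      field_simp
      ring

/-- Mixed-radix expansion: as $Q_i\beta_i$ is invertible modulo $q_i$, a digit below $q_i$ brings
$r$ from $\frac1{Q_i}\mathbb Z$ into $\frac1{Q_{i-1}}\mathbb Z$. The integer left at the end may be
negative here. -/
theorem exists_expansion (h : IsJumpingValues β p q N) {i : ℕ} (hi : i ≤ N) :
    ∀ r : ℚ, (∃ m : ℤ, (∏ j ∈ Finset.Icc 1 i, (q j : ℚ)) * r = m) →
      ∃ (n₀ : ℤ) (n : ℕ → ℕ), (∀ j, 0 < j → j ≤ i → n j < q j) ∧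
        r = n₀ + ∑ j ∈ Finset.Icc 1 i, (n j : ℚ) * β j := by
  induction i with
  | zero =>
    rintro r ⟨m, hm⟩
    exact ⟨m, 0, by omega, by simpa using hm⟩
  | succ i ih =>
    rintro r ⟨m, hm⟩
    obtain ⟨b, hb, hcop⟩ := h.exists_int_eq hi
    obtain ⟨s, t, hst⟩ := hcop (by omega)
    have hqn := h.q_pos (i + 1) (by omega) hi
    have hq0 : (0 : ℤ) < q (i + 1) := by exact_mod_cast hqn
    -- By Bézout, `s` inverts `b` modulo `q (i + 1)`, so this digit `a` solves `a * b ≡ m`.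
    obtain ⟨a, ha⟩ := Int.eq_ofNat_of_zero_le (Int.emod_nonneg (m * s) hq0.ne')
    have haq : a < q (i + 1) := by
      have := Int.emod_lt_of_pos (m * s) hq0
      omega
    have hdiv := Int.emod_add_mul_ediv (m * s) (q (i + 1))
    rw [ha] at hdiv
    have hl : m - a * b = q (i + 1) * (m * t + b * (m * s / q (i + 1))) := by
      linear_combination (-m) * hst - b * hdiv
    have hl' : (m : ℚ) - a * b = q (i + 1) * (m * t + b * (m * s / q (i + 1) : ℤ) : ℤ) := by
      exact_mod_cast hl
    have hq : (0 : ℚ) < q (i + 1) := by exact_mod_cast hqn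
    rw [Finset.prod_Icc_succ_top (by omega)] at hm hb
    obtain ⟨n₀, n, hn, hsum⟩ := ih (by omega) (r - a * β (i + 1))
      ⟨m * t + b * (m * s / q (i + 1)), by
        apply mul_left_cancel₀ hq.ne'
        rw [← hl', ← hm, ← hb]
        ring⟩
    refine ⟨n₀, Function.update n (i + 1) a, fun j hj hji => ?_, ?_⟩
    · rcases eq_or_ne j (i + 1) with rfl | hne
      · simpa using haq
      · rw [Function.update_of_ne hne]
        exact hn j hj (by omega)
    · rw [Finset.sum_Icc_succ_top (by omega), Function.update_self]
      have : ∑ j ∈ Finset.Icc 1 i, (Function.update n (i + 1) a j : ℚ) * β j =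
          ∑ j ∈ Finset.Icc 1 i, (n j : ℚ) * β j := by
        refine Finset.sum_congr rfl fun j hj => ?_
        have := Finset.mem_Icc.mp hj
        rw [Function.update_of_ne (by omega)]
      rw [this]
      linear_combination hsum

theorem pos (h : IsJumpingValues β p q N) {i : ℕ} (hi : i ≤ N) : 0 < β i := by
  induction i with
  | zero => simp [h.zero]
  | succ i ih =>
    have hQ := h.prod_pos (i := i) (by omega)
    have hp : (0 : ℚ) < p (i + 1) := by exact_mod_cast h.p_pos _ (by omega) hi
    have hq : (0 : ℚ) < q (i + 1) := by exact_mod_cast h.q_pos _ (by omega) hi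
    have hβ := ih (by omega)
    rw [h.succ i hi]
    split_ifs <;> positivity

/-- The digits below the top one contribute less than $\beta_i$, and $(n_i+1)\beta_i\le
q_i\beta_i<\beta_{i+1}$. -/
theorem sum_lt (h : IsJumpingValues β p q N) {n : ℕ → ℕ} {i : ℕ} (hi : i + 1 ≤ N)
    (hn : ∀ j, 0 < j → j ≤ i → n j < q j) :
    ∑ j ∈ Finset.Icc 1 i, (n j : ℚ) * β j < β (i + 1) := by
  induction i with
  | zero => simpa using h.pos hi
  | succ i ih =>
    have h1 := ih (by omega) fun j hj hji => hn j hj (by omega)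
    have hQ := h.prod_pos (i := i + 1) (by omega)
    have hp : (0 : ℚ) < p (i + 1 + 1) := by exact_mod_cast h.p_pos _ (by omega) hi
    have hq : (0 : ℚ) < q (i + 1 + 1) := by exact_mod_cast h.q_pos _ (by omega) hi
    have hnq : (n (i + 1) : ℚ) + 1 ≤ q (i + 1) := by
      exact_mod_cast hn (i + 1) (by omega) le_rfl
    have hpos : 0 < 1 / (∏ j ∈ Finset.Icc 1 (i + 1), (q j : ℚ)) *
      ((p (i + 1 + 1) : ℚ) / q (i + 1 + 1)) := by positivity
    rw [Finset.sum_Icc_succ_top (by omega), h.succ (i + 1) hi, if_neg (by omega)]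
    have h2 := mul_le_mul_of_nonneg_right hnq (h.pos (i := i + 1) (by omega)).le
    linarith

theorem exists_exponents (h : IsJumpingValues β p q N) {i : ℕ} (hi : i + 1 ≤ N) :
    ∃ n : ℕ → ℕ, (∀ j, 0 < j → j < i + 1 → n j < q j) ∧
      (q (i + 1) : ℚ) * β (i + 1) = ∑ j ∈ Finset.range (i + 1), (n j : ℚ) * β j := by
  obtain ⟨m, hm, -⟩ := h.exists_int_eq hi
  rw [Finset.prod_Icc_succ_top (by omega), mul_assoc] at hm
  obtain ⟨n₀, n, hn, hsum⟩ := h.exists_expansion (by omega) _ ⟨m, hm⟩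
  have hlt := h.sum_lt hi hn
  have hq : (1 : ℚ) ≤ q (i + 1) := by exact_mod_cast h.q_pos _ (by omega) hi
  have hle : β (i + 1) ≤ q (i + 1) * β (i + 1) := le_mul_of_one_le_left (h.pos hi).le hq
  -- The other digits sum to less than `β (i + 1)`, so the integer part is positive and is an
  -- admissible exponent of `T 0`.
  have hn₀ : 0 < n₀ := by
    have : (0 : ℚ) < n₀ := by linarith
    exact_mod_cast this
  refine ⟨Function.update n 0 n₀.toNat, fun j hj hji => ?_, ?_⟩
  · rw [Function.update_of_ne hj.ne']
    exact hn j hj (by omega)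
  · rw [Finset.sum_range_succ', Function.update_self, hsum, h.zero, mul_one, add_comm]
    congr 1
    · rw [Finset.range_eq_Ico, Finset.sum_Ico_add' (fun j => (Function.update n 0 n₀.toNat j : ℚ) * β j)]
      refine Finset.sum_congr (by ext; simp) fun j hj => ?_
      have := Finset.mem_Ico.mp hj
      rw [Function.update_of_ne (by omega)]
    · have : ((n₀.toNat : ℤ) : ℚ) = n₀ := by rw [Int.toNat_of_nonneg hn₀.le]
      exact_mod_cast this.symm

end IsJumpingValues

end JumpingValues

/-! ### Jumping polynomials row by row, and the main induction. -/

section JumpingRows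

variable {k K : Type*} [Field k] [Field K] [Algebra k K]

/-- The data which the construction of the jumping polynomials attaches to an index `i`. -/
structure JumpingRow (S : Subalgebra k K) where
  T : S
  β : ℚ
  p : ℕ
  q : ℕ
  n : ℕ → ℕ
  c : k

/-- The monomial `∏ T j ^ n i j`, over `j < i`. -/
def jumpingMonomial {S : Subalgebra k K} (f : ℕ → JumpingRow S) (i : ℕ) : S :=
  ∏ j ∈ Finset.range i, (f j).T ^ (f i).n j

/-- The `i`-th row of `f` is obtained from the previous rows by the construction of the jumping
polynomials. -/
structure IsJumpingRow (ν : AddValuation K (WithTop ℚ)) {S : Subalgebra k K} (x y : S)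
    (f : ℕ → JumpingRow S) (i : ℕ) : Prop where
  value : ν ((f i).T : K) = ((f i).β : WithTop ℚ)
  zero : i = 0 → (f i).T = x
  one : i = 1 → (f i).T = y ∧ (f i).β = ((f i).p : ℚ) / (f i).q
  p_pos : 0 < i → 0 < (f i).p
  q_pos : 0 < i → 0 < (f i).q
  coprime : 0 < i → (f i).p.Coprime (f i).q
  n_lt : ∀ j, 0 < j → j < i → (f i).n j < (f j).q
  n_value : 0 < i → ((f i).q : ℚ) * (f i).β = ∑ j ∈ Finset.range i, ((f i).n j : ℚ) * (f j).β
  residue : 0 < i → IsResidue ν (((f i).T : K) ^ (f i).q / jumpingMonomial f i) (f i).c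
  succ : ∀ j, 0 < j → i = j + 1 →
    (f i).T = (f j).T ^ (f j).q - algebraMap k S (f j).c * jumpingMonomial f j ∧
    (f i).β = (f j).q * (f j).β +
      1 / (∏ l ∈ Finset.Icc 1 j, ((f l).q : ℚ)) * (((f i).p : ℚ) / (f i).q)

/-- The rows of a jumping sequence. -/
def JumpingSequence.row {ν : AddValuation K (WithTop ℚ)} {S : Subalgebra k K} {x y : S}
    (J : JumpingSequence ν x y) (i : ℕ) : JumpingRow S :=
  ⟨J.T i, J.β i, J.p i, J.q i, J.n i, J.c i⟩

theorem JumpingSequence.isJumpingRow {ν : AddValuation K (WithTop ℚ)} {S : Subalgebra k K}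
    {x y : S} (J : JumpingSequence ν x y) (i : ℕ) : IsJumpingRow ν x y J.row i where
  value := J.value i
  zero := by rintro rfl; exact J.T_zero
  one := by rintro rfl; exact ⟨J.T_one, J.β_one⟩
  p_pos := J.p_pos i
  q_pos := J.q_pos i
  coprime := J.coprime i
  n_lt := J.n_lt i
  n_value := J.n_value i
  residue := fun hi => by
    have := J.c_residue i hi
    simpa [jumpingMonomial, JumpingSequence.row] using this
  succ := by
    rintro j hj rfl
    exact ⟨J.T_succ j hj, J.β_succ j hj⟩

/-- A jumping sequence with prescribed rows. -/
def JumpingSequence.ofRows {ν : AddValuation K (WithTop ℚ)} {S : Subalgebra k K} {x y : S}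
    (f : ℕ → JumpingRow S) (h : ∀ i, IsJumpingRow ν x y f i) : JumpingSequence ν x y where
  T i := (f i).T
  β i := (f i).β
  p i := (f i).p
  q i := (f i).q
  n i := (f i).n
  c i := (f i).c
  T_zero := (h 0).zero rfl
  T_one := ((h 1).one rfl).1
  value i := (h i).value
  p_pos i := (h i).p_pos
  q_pos i := (h i).q_pos
  coprime i := (h i).coprime
  β_one := ((h 1).one rfl).2
  n_lt i := (h i).n_lt
  n_value i := (h i).n_value
  c_residue i hi := by
    have := (h i).residue hi
    simpa [jumpingMonomial] using this
  T_succ i hi := ((h (i + 1)).succ i hi rfl).1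
  β_succ i hi := ((h (i + 1)).succ i hi rfl).2

variable {ν : AddValuation K (WithTop ℚ)} {S : Subalgebra k K} {x y : S} {f : ℕ → JumpingRow S}

theorem AddValuation.map_prod_pow (ν : AddValuation K (WithTop ℚ)) {t : ℕ → K} {β : ℕ → ℚ}
    (s : Finset ℕ) (n : ℕ → ℕ) (h : ∀ j ∈ s, ν (t j) = (β j : WithTop ℚ)) :
    ν (∏ j ∈ s, t j ^ n j) = ((∑ j ∈ s, (n j : ℚ) * β j : ℚ) : WithTop ℚ) := by
  classical
  induction s using Finset.induction_on with
  | empty => simp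
  | insert a s ha ih =>
    rw [Finset.prod_insert ha, Finset.sum_insert ha, AddValuation.map_mul,
      ih fun j hj => h j (Finset.mem_insert_of_mem hj), AddValuation.map_pow,
      h a (Finset.mem_insert_self _ _), ← WithTop.coe_nsmul, nsmul_eq_mul, WithTop.coe_add]

theorem exists_prod_pow_eq {ν : AddValuation K (WithTop ℚ)} {B : Subalgebra k K} {w : K}
    {t : ℕ → K} (s : Finset ℕ) (n : ℕ → ℕ)
    (h : ∀ j ∈ s, ∃ (m : ℕ) (γ : K), γ ∈ B ∧ ν γ = 0 ∧ t j = w ^ m * γ) :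
    ∃ (m : ℕ) (γ : K), γ ∈ B ∧ ν γ = 0 ∧ ∏ j ∈ s, t j ^ n j = w ^ m * γ := by
  classical
  induction s using Finset.induction_on with
  | empty => exact ⟨0, 1, B.one_mem, AddValuation.map_one ν, by simp⟩
  | insert a s ha ih =>
    obtain ⟨m, γ, hγ, hγ0, hm⟩ := ih fun j hj => h j (Finset.mem_insert_of_mem hj)
    obtain ⟨m', γ', hγ', hγ0', hm'⟩ := h a (Finset.mem_insert_self _ _)
    refine ⟨m' * n a + m, γ' ^ n a * γ, B.mul_mem (B.pow_mem hγ' _) hγ, ?_, ?_⟩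
    · rw [AddValuation.map_mul, AddValuation.map_pow, hγ0, hγ0', smul_zero, add_zero]
    · rw [Finset.prod_insert ha, hm, hm']
      ring

theorem coe_jumpingMonomial (f : ℕ → JumpingRow S) (i : ℕ) :
    (jumpingMonomial f i : K) = ∏ j ∈ Finset.range i, ((f j).T : K) ^ (f i).n j := by
  simp [jumpingMonomial]

open Classical in
/-- The second regular parameter of the `i`-th free ring. -/
noncomputable def jumpingParameter (y : S) (f : ℕ → JumpingRow S) (i : ℕ) : K :=
  if i = 0 then y
  else ((f i).T : K) ^ (f i).q / jumpingMonomial f i - algebraMap k K (f i).c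

/-- The index of the `i`-th free ring. -/
def jumpingIndex (f : ℕ → JumpingRow S) (i : ℕ) : ℕ :=
  ∑ j ∈ Finset.Icc 1 i, euclidSum (f j).p (f j).q

/-- `Q i = q 1 ⋯ q i`. -/
def jumpingDenominator (f : ℕ → JumpingRow S) (i : ℕ) : ℚ :=
  ∏ j ∈ Finset.Icc 1 i, ((f j).q : ℚ)

theorem jumpingIndex_succ (f : ℕ → JumpingRow S) (i : ℕ) :
    jumpingIndex f (i + 1) = euclidSum (f (i + 1)).p (f (i + 1)).q + jumpingIndex f i := by
  rw [jumpingIndex, Finset.sum_Icc_succ_top (by omega), add_comm]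
  rfl

theorem jumpingDenominator_succ (f : ℕ → JumpingRow S) (i : ℕ) :
    jumpingDenominator f (i + 1) = jumpingDenominator f i * (f (i + 1)).q :=
  Finset.prod_Icc_succ_top (by omega) _

namespace IsJumpingRow

theorem coe_ne_zero {i : ℕ} (h : IsJumpingRow ν x y f i) : ((f i).T : K) ≠ 0 := by
  rw [← AddValuation.ne_top_iff ν, h.value]
  exact WithTop.coe_ne_top

theorem jumpingMonomial_ne_zero {i : ℕ} (h : ∀ j < i, IsJumpingRow ν x y f j) :
    (jumpingMonomial f i : K) ≠ 0 := by
  rw [coe_jumpingMonomial]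
  exact Finset.prod_ne_zero_iff.mpr fun j hj =>
    pow_ne_zero _ (h j (Finset.mem_range.mp hj)).coe_ne_zero

theorem value_jumpingMonomial {i : ℕ} (hi : 0 < i) (h : ∀ j ≤ i, IsJumpingRow ν x y f j) :
    ν (jumpingMonomial f i : K) = (((f i).q * (f i).β : ℚ) : WithTop ℚ) := by
  rw [coe_jumpingMonomial, (h i le_rfl).n_value hi]
  exact ν.map_prod_pow _ _ fun j hj => (h j (Finset.mem_range.mp hj).le).value

/-- The case `i = 0` fits in because the parameter is then `y` and the monomial is an empty product.
-/
theorem coe_succ {i : ℕ} (h : ∀ j ≤ i + 1, IsJumpingRow ν x y f j) :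
    ((f (i + 1)).T : K) = jumpingParameter y f i * jumpingMonomial f i := by
  rcases Nat.eq_zero_or_pos i with rfl | hi
  · simp [jumpingParameter, jumpingMonomial, ((h 1 le_rfl).one rfl).1]
  · have hne := jumpingMonomial_ne_zero (i := i) fun j hj => h j (by omega)
    rw [jumpingParameter, if_neg hi.ne', ((h (i + 1) le_rfl).succ i hi rfl).1, sub_mul,
      div_mul_cancel₀ _ hne]
    rfl

theorem value_jumpingParameter {i : ℕ} (h : ∀ j ≤ i + 1, IsJumpingRow ν x y f j) :
    ν (jumpingParameter y f i) =
      ((1 / jumpingDenominator f i * ((f (i + 1)).p / (f (i + 1)).q) : ℚ) : WithTop ℚ) := by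
  have h1 := (h (i + 1) le_rfl).value
  rcases Nat.eq_zero_or_pos i with rfl | hi
  · rw [jumpingParameter, if_pos rfl, ← ((h 1 le_rfl).one rfl).1, h1, ((h 1 le_rfl).one rfl).2]
    simp [jumpingDenominator]
  · have hne := jumpingMonomial_ne_zero (i := i) fun j hj => h j (by omega)
    refine WithTop.add_right_cancel (ν.ne_top_of_ne_zero hne) ?_
    rw [← AddValuation.map_mul, ← coe_succ h, h1, value_jumpingMonomial hi fun j hj => h j (by omega),
      ((h (i + 1) le_rfl).succ i hi rfl).2, ← WithTop.coe_add, add_comm]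
    rfl

theorem jumpingDenominator_pos {i : ℕ} (h : ∀ j ≤ i, IsJumpingRow ν x y f j) :
    0 < jumpingDenominator f i :=
  Finset.prod_pos fun j hj => by
    have := Finset.mem_Icc.mp hj
    exact_mod_cast (h j (by omega)).q_pos (by omega)

/-- After `k_i` quadratic transforms, the parameter `y_i` belongs to a regular system of parameters
with respect to which the first jumping polynomials are monomials. -/
theorem exists_regularSystem (hS : RegularSystem ν S (x : K) y)
    (hx : ν (x : K) = ((1 : ℚ) : WithTop ℚ))
    (hres : ∀ f : K, ν f = 0 → ∃ c : k, IsResidue ν f c) (i : ℕ)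
    (h : ∀ j ≤ i, IsJumpingRow ν x y f j) :
    S ≤ (quadraticTransform ν)^[jumpingIndex f i] S ∧
    ∃ w : K, RegularSystem ν ((quadraticTransform ν)^[jumpingIndex f i] S) w
        (jumpingParameter y f i) ∧
      ν w = ((1 / jumpingDenominator f i : ℚ) : WithTop ℚ) ∧
      ∀ j ≤ i, ∃ (m : ℕ) (γ : K), γ ∈ (quadraticTransform ν)^[jumpingIndex f i] S ∧ ν γ = 0 ∧
        ((f j).T : K) = w ^ m * γ := by
  induction i with
  | zero =>
    refine ⟨le_rfl, x, by simpa [jumpingIndex, jumpingParameter] using hS,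
      by simpa [jumpingDenominator] using hx, fun j hj => ?_⟩
    obtain rfl : j = 0 := by omega
    exact ⟨1, 1, Subalgebra.one_mem _, AddValuation.map_one ν, by simp [(h 0 le_rfl).zero rfl]⟩
  | succ i ih =>
    obtain ⟨hle, w, hw, hwv, hmon⟩ := ih fun j hj => h j (by omega)
    have hi := h (i + 1) le_rfl
    have hQ := jumpingDenominator_pos (i := i) fun j hj => h j (by omega)
    have hp := hi.p_pos (by omega)
    have hq := hi.q_pos (by omega)
    have hzv := value_jumpingParameter h
    have hT := coe_succ h
    obtain ⟨M, e₁, he₁, he₁0, hM⟩ := exists_prod_pow_eq (Finset.range i) (f i).n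
      fun j hj => hmon j (Finset.mem_range.mp hj).le
    obtain ⟨M', e₂, he₂, he₂0, hM'⟩ := exists_prod_pow_eq (Finset.range (i + 1)) (f (i + 1)).n
      fun j hj => hmon j (Finset.mem_range_succ_iff.mp hj)
    have hmonv := value_jumpingMonomial (by omega) h
    rw [← coe_jumpingMonomial] at hM hM'
    set Q := jumpingDenominator f i with hQdef
    set z := jumpingParameter y f i with hzdef
    set q := (f (i + 1)).q with hqdef
    set p := (f (i + 1)).p with hpdef
    set B := (quadraticTransform ν)^[jumpingIndex f i] S with hB
    have hq0 : (0 : ℚ) < q := by exact_mod_cast hq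
    -- Compare values: $T_{i+1}=z\,w^M e_1$ has value $M/Q+p/(Qq)$, and the next monomial, of value
    -- $M'/Q$, has $q$ times that value.
    have hexp : M' = p + M * q := by
      have h1 := hi.value
      rw [hT, hM, AddValuation.map_mul, AddValuation.map_mul, AddValuation.map_pow, he₁0, add_zero,
        hzv, hwv, ← WithTop.coe_nsmul, ← WithTop.coe_add] at h1
      have h1' := WithTop.coe_injective h1
      rw [hM', AddValuation.map_mul, AddValuation.map_pow, he₂0, add_zero, hwv,
        ← WithTop.coe_nsmul] at hmonv
      have h2' := WithTop.coe_injective hmonv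
      rw [nsmul_eq_mul] at h1' h2'
      rw [← h1'] at h2'
      have h3 : (M' : ℚ) = p + M * q := by
        field_simp at h2'
        linear_combination h2'
      exact_mod_cast h3
    have hw0 := hw.left_ne
    have he₂n := ν.ne_zero_of_eq_zero he₂0
    -- The powers of `w` now cancel down to `w ^ p`, so the ratio defining the next constant is the
    -- Euclidean ratio times a unit of the current ring.
    have hratio : ((f (i + 1)).T : K) ^ q / jumpingMonomial f (i + 1) =
        (e₁ ^ q * e₂⁻¹) * (z ^ q / w ^ p) := by
      rw [hT, hM, hM', hexp, pow_add, pow_mul]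
      field_simp
      ring
    have hc := hi.residue (by omega)
    have hpar : jumpingParameter y f (i + 1) =
        (e₁ ^ q * e₂⁻¹) * (z ^ q / w ^ p) - algebraMap k K (f (i + 1)).c := by
      rw [← hratio, jumpingParameter, if_neg (by omega)]
    rw [hratio] at hc
    have heB : e₁ ^ q * e₂⁻¹ ∈ B := B.mul_mem (B.pow_mem he₁ _) (hw.inv_mem _ he₂ he₂0)
    have he0 : ν (e₁ ^ q * e₂⁻¹) = 0 := by
      rw [AddValuation.map_mul, AddValuation.map_pow, he₁0, smul_zero, zero_add]
      exact (AddValuation.val_inv_of_eq_zero ν he₂0).2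
    have hwg : ν w = ((q * (1 / (Q * q)) : ℚ) : WithTop ℚ) := by
      rw [hwv]
      congr 1
      field_simp
    have hzg : ν z = ((p * (1 / (Q * q)) : ℚ) : WithTop ℚ) := by
      rw [hzv]
      congr 1
      field_simp
    obtain ⟨hle', w', hw', hwv', ⟨g, hg, hg0, hwg'⟩, g', hg', hg0', hzg'⟩ :=
      hw.exists_iterate_quadraticTransform_unit_mul hp hq (hi.coprime (by omega)) hwg hzg hres
        heB he0 hc
    rw [jumpingIndex_succ, Function.iterate_add_apply, hpar, jumpingDenominator_succ]
    refine ⟨hle.trans hle', w', hw', hwv', fun j hj => ?_⟩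
    rcases Nat.lt_or_ge i j with hij | hij
    · obtain rfl : j = i + 1 := by omega
      refine ⟨p + q * M, g' * g ^ M * e₁, Subalgebra.mul_mem _ (Subalgebra.mul_mem _ hg'
        (Subalgebra.pow_mem _ hg _)) (hle' he₁), ?_, ?_⟩
      · rw [AddValuation.map_mul, AddValuation.map_mul, AddValuation.map_pow, hg0, hg0', he₁0,
          smul_zero, add_zero, add_zero]
      · rw [hT, hM, hzg', hwg']
        ring
    · obtain ⟨m, γ, hγ, hγ0, hm⟩ := hmon j hij
      refine ⟨q * m, g ^ m * γ, Subalgebra.mul_mem _ (Subalgebra.pow_mem _ hg _) (hle' hγ), ?_, ?_⟩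
      · rw [AddValuation.map_mul, AddValuation.map_pow, hg0, hγ0, smul_zero, add_zero]
      · rw [hm, hwg']
        ring

end IsJumpingRow

end JumpingRows

/-! ### Residues, free rings and strict transforms. -/

section Transforms

open IsLocalRing

variable {k K : Type*} [Field k] [Field K] [Algebra k K]

theorem exists_isResidue [IsAlgClosed k] {ν : AddValuation K (WithTop ℚ)}
    {hν : IsKValuation k ν} (hν0 : IsZeroDimensional ν hν) {f : K} (hf : ν f = 0) :
    ∃ c : k, IsResidue ν f c := by
  have halg : Algebra.IsAlgebraic k (ResidueField (valuationAlgebra ν hν)) :=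
    trdeg_eq_zero_iff.mp hν0
  obtain ⟨c, hc⟩ := (IsAlgClosed.algebraMap_bijective_of_isIntegral
    (k := k) (K := ResidueField (valuationAlgebra ν hν))).2
    (residue _ (⟨f, hf.ge⟩ : valuationAlgebra ν hν))
  refine ⟨c, ?_⟩
  have h1 : residue _ ((⟨f, hf.ge⟩ : valuationAlgebra ν hν) - algebraMap k _ c) = 0 := by
    rw [map_sub, ← hc]
    exact sub_self _
  rw [residue_eq_zero_iff, mem_maximalIdeal, mem_nonunits_iff] at h1
  have h2 := fun h0 => h1 (valuationAlgebra_isUnit h0)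
  exact lt_of_le_of_ne (Subtype.coe_prop
    ((⟨f, hf.ge⟩ : valuationAlgebra ν hν) - algebraMap k _ c)) (Ne.symm h2)

theorem mem_curvePreimage {A B : Subalgebra k K} (h : A ≤ B) (x : A) (P : PrimeSpectrum B) :
    P ∈ curvePreimage h x ↔ Subalgebra.inclusion h x ∈ P.asIdeal := by
  simp [curvePreimage, PrimeSpectrum.mem_zeroLocus]

namespace RegularSystem

variable {ν : AddValuation K (WithTop ℚ)} {A B : Subalgebra k K} {u v w z : K}

theorem curvePreimage_eq (hB : RegularSystem ν B w z) (hle : A ≤ B) {x : A} {m : ℕ} (hm : m ≠ 0)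
    {γ : K} (hγ : γ ∈ B) (hγ0 : ν γ = 0) (hx : (x : K) = w ^ m * γ) :
    curvePreimage hle x = PrimeSpectrum.zeroLocus {(⟨w, hB.left_mem⟩ : B)} := by
  have heq : Subalgebra.inclusion hle x = ⟨w, hB.left_mem⟩ ^ m * ⟨γ, hγ⟩ := Subtype.ext hx
  have hunit : IsUnit (⟨γ, hγ⟩ : B) := hB.isUnit_iff.mpr hγ0
  ext P
  rw [mem_curvePreimage, heq, Ideal.mul_unit_mem_iff_mem _ hunit,
    P.isPrime.pow_mem_iff_mem m (Nat.pos_of_ne_zero hm)]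
  simp [PrimeSpectrum.mem_zeroLocus]

/-- The preimage is the zero locus of the prime element `w`, hence irreducible. -/
theorem isFreeRing (hB : RegularSystem ν B w z) (hle : A ≤ B) {x : A} {m : ℕ} (hm : m ≠ 0)
    {γ : K} (hγ : γ ∈ B) (hγ0 : ν γ = 0) (hx : (x : K) = w ^ m * γ) : IsFreeRing hle x := by
  have hpr : (Ideal.span {(⟨w, hB.left_mem⟩ : B)}).IsPrime :=
    (Ideal.span_singleton_prime hB.prime_left.ne_zero).mpr hB.prime_left
  have hirr : IsIrreducible (curvePreimage hle x) := by
    rw [hB.curvePreimage_eq hle hm hγ hγ0 hx, ← PrimeSpectrum.zeroLocus_span,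
      PrimeSpectrum.isIrreducible_zeroLocus_iff, hpr.isRadical.radical]
    exact hpr
  have : IrreducibleSpace (curvePreimage hle x) := Subtype.irreducibleSpace hirr
  rw [IsFreeRing, irreducibleComponents_eq_singleton]
  exact ⟨Set.univ, rfl, fun _ h => h⟩

/-- The maximal ideal of `A` extends into `(w)`, so its `M`-th power supplies the factor `w ^ M` of
`f`. Conversely, the extension contains `u`, a unit times a power of `w`; the prime `z` divides no
such power, so it can be cancelled. -/
theorem isStrictTransform [IsLocalRing A] (hA : RegularSystem ν A u v)
    (hB : RegularSystem ν B w z) (hle : A ≤ B) {m m' M : ℕ} {γ γ' ε : K} (hm : m ≠ 0)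
    (hm' : m' ≠ 0) (hγ : γ ∈ B) (hγ0 : ν γ = 0) (hγ' : γ' ∈ B) (hu : u = w ^ m * γ)
    (hv : v = w ^ m' * γ') (hε : ε ∈ B) (hε0 : ν ε = 0) {f : A}
    (hf : (f : K) = z * (w ^ M * ε)) : IsStrictTransform hle f ⟨z, hB.right_mem⟩ := by
  have hmap : (maximalIdeal A).map (Subalgebra.inclusion hle).toRingHom ≤
      Ideal.span {⟨w, hB.left_mem⟩} := by
    rw [hA.maximalIdeal_eq, Ideal.map_span, Ideal.span_le, Set.image_pair]
    have hdvd : ∀ {t : B} {n : ℕ} {δ : K}, n ≠ 0 → δ ∈ B → (t : K) = w ^ n * δ →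
        t ∈ Ideal.span {(⟨w, hB.left_mem⟩ : B)} := by
      intro t n δ hn hδ ht
      rw [Ideal.mem_span_singleton]
      obtain rfl : t = ⟨w, hB.left_mem⟩ ^ n * ⟨δ, hδ⟩ := Subtype.ext ht
      exact (dvd_pow_self _ hn).mul_right _
    rintro t (rfl | rfl)
    · exact hdvd hm hγ hu
    · exact hdvd hm' hγ' hv
  have hfB : Subalgebra.inclusion hle f =
      ⟨z, hB.right_mem⟩ * (⟨w, hB.left_mem⟩ ^ M * ⟨ε, hε⟩) := Subtype.ext hf
  have hεu : IsUnit (⟨ε, hε⟩ : B) := hB.isUnit_iff.mpr hε0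
  have hγu : IsUnit (⟨γ, hγ⟩ : B) := hB.isUnit_iff.mpr hγ0
  intro a
  rw [hfB]
  constructor
  · intro ha
    refine ⟨M, fun e he => ?_⟩
    have he' := Ideal.pow_right_mono hmap M he
    rw [Ideal.span_singleton_pow, Ideal.mem_span_singleton] at he'
    rw [Ideal.mem_span_singleton] at ha ⊢
    rw [← mul_assoc, hεu.mul_right_dvd, mul_comm]
    exact mul_dvd_mul he' ha
  · rintro ⟨N, hN⟩
    have hmem : Subalgebra.inclusion hle ⟨u, hA.left_mem⟩ ∈
        (maximalIdeal A).map (Subalgebra.inclusion hle).toRingHom := by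
      refine Ideal.mem_map_of_mem (Subalgebra.inclusion hle).toRingHom ?_
      rw [mem_maximalIdeal, hA.mem_nonunits]
      exact hA.left_pos
    have h1 := hN _ (Ideal.pow_mem_pow hmem N)
    have huB : Subalgebra.inclusion hle ⟨u, hA.left_mem⟩ =
        ⟨w, hB.left_mem⟩ ^ m * ⟨γ, hγ⟩ := Subtype.ext hu
    rw [huB, Ideal.mem_span_singleton] at h1
    have hp := hB.swap.prime_left
    rw [Ideal.mem_span_singleton]
    refine (hp.dvd_or_dvd (dvd_of_mul_right_dvd h1)).resolve_left fun h2 => ?_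
    have h3 := hp.dvd_of_dvd_pow h2
    rw [hγu.dvd_mul_right] at h3
    exact hB.swap.not_dvd_pow m h3

end RegularSystem

end Transforms

/-! ### Existence of the jumping sequence, and the theorem. -/

section Construction

/-- Dependent choice with memory: the condition at `n` sees only the entries up to `n`, so later
updates preserve it and the diagonal of the approximations satisfies all conditions. -/
theorem exists_forall_of_forall_exists_update {α : Type*} [Inhabited α] (P : (ℕ → α) → ℕ → Prop)
    (hcongr : ∀ f g n, (∀ m ≤ n, f m = g m) → P f n → P g n)
    (hstep : ∀ f n, (∀ m < n, P f m) → ∃ a, P (Function.update f n a) n) : ∃ f, ∀ n, P f n := by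
  choose a ha using hstep
  let G : (n : ℕ) → {f : ℕ → α // ∀ m < n, P f m} := fun n => Nat.rec ⟨default, by simp⟩
    (fun n f => ⟨Function.update f.1 n (a f.1 n f.2), fun m hm => by
      rcases Nat.lt_succ_iff_lt_or_eq.mp hm with hlt | rfl
      · exact hcongr f.1 _ m (fun l hl => (Function.update_of_ne (by omega) _ _).symm) (f.2 m hlt)
      · exact ha f.1 m f.2⟩) n
  have hG : ∀ n m, m ≠ n → (G (n + 1)).1 m = (G n).1 m := fun n m hm =>
    Function.update_of_ne hm _ _
  have hG' : ∀ m n, m < n → (G n).1 m = (G (m + 1)).1 m := by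
    intro m n hmn
    induction n, hmn using Nat.le_induction with
    | base => rfl
    | succ n hn ih => rw [hG n m (by omega), ih]
  exact ⟨fun n => (G (n + 1)).1 n, fun n => hcongr (G (n + 1)).1 _ n
    (fun m hm => hG' m (n + 1) (by omega)) ((G (n + 1)).2 n (by omega))⟩

variable {k K : Type*} [Field k] [Field K] [Algebra k K]
  {ν : AddValuation K (WithTop ℚ)} {S : Subalgebra k K} {x y : S}

theorem IsJumpingRow.congr {f g : ℕ → JumpingRow S} {i : ℕ} (h : IsJumpingRow ν x y f i)
    (hfg : ∀ j ≤ i, f j = g j) : IsJumpingRow ν x y g i := by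
  have hmon : ∀ j ≤ i, jumpingMonomial f j = jumpingMonomial g j := fun j hj =>
    Finset.prod_congr rfl fun l hl => by
      have := Finset.mem_range.mp hl
      rw [hfg j hj, hfg l (by omega)]
  have hi := hfg i le_rfl
  refine ⟨hi ▸ h.value, hi ▸ h.zero, hi ▸ h.one, hi ▸ h.p_pos, hi ▸ h.q_pos, hi ▸ h.coprime,
    fun j hj hji => ?_, fun h0 => ?_, fun h0 => ?_, fun j hj hij => ?_⟩
  · rw [← hi, ← hfg j hji.le]
    exact h.n_lt j hj hji
  · rw [← hi, h.n_value h0]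
    exact Finset.sum_congr rfl fun j hj => by rw [hfg j (Finset.mem_range.mp hj).le]
  · rw [← hi, ← hmon i le_rfl]
    exact h.residue h0
  · have hprod : ∏ l ∈ Finset.Icc 1 j, ((g l).q : ℚ) = ∏ l ∈ Finset.Icc 1 j, ((f l).q : ℚ) :=
      Finset.prod_congr rfl fun l hl => by
        have := Finset.mem_Icc.mp hl
        rw [hfg l (by omega)]
    rw [← hi, ← hfg j (by omega), ← hmon j (by omega), hprod]
    exact h.succ j hj hij

theorem isJumpingValues_of_isJumpingRow {f : ℕ → JumpingRow S}
    (hx : ν (x : K) = ((1 : ℚ) : WithTop ℚ)) {N : ℕ} (h : ∀ j ≤ N, IsJumpingRow ν x y f j) :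
    IsJumpingValues (fun j => (f j).β) (fun j => (f j).p) (fun j => (f j).q) N where
  zero := by
    have h0 := (h 0 (Nat.zero_le _)).value
    rw [(h 0 (Nat.zero_le _)).zero rfl, hx] at h0
    exact (WithTop.coe_injective h0).symm
  p_pos i h0 hi := (h i hi).p_pos h0
  q_pos i h0 hi := (h i hi).q_pos h0
  coprime i h0 hi := (h i hi).coprime h0
  succ i hi := by
    rcases Nat.eq_zero_or_pos i with rfl | h0
    · simpa using ((h 1 hi).one rfl).2
    · rw [if_neg h0.ne', ((h (i + 1) hi).succ i h0 rfl).2]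

theorem IsJumpingValues.extend {β β' : ℕ → ℚ} {p q p' q' : ℕ → ℕ} {N : ℕ}
    (h : IsJumpingValues β p q N) (hβ : ∀ j ≤ N, β' j = β j) (hp : ∀ j ≤ N, p' j = p j)
    (hq : ∀ j ≤ N, q' j = q j) (hp0 : 0 < p' (N + 1)) (hq0 : 0 < q' (N + 1))
    (hpq : (p' (N + 1)).Coprime (q' (N + 1)))
    (hs : β' (N + 1) = (if N = 0 then 0 else q N * β N) +
      1 / (∏ j ∈ Finset.Icc 1 N, (q j : ℚ)) * ((p' (N + 1) : ℚ) / q' (N + 1))) :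
    IsJumpingValues β' p' q' (N + 1) := by
  have hprod : ∀ i ≤ N, ∏ j ∈ Finset.Icc 1 i, (q' j : ℚ) = ∏ j ∈ Finset.Icc 1 i, (q j : ℚ) :=
    fun i hi => Finset.prod_congr rfl fun j hj => by
      have := Finset.mem_Icc.mp hj
      rw [hq j (by omega)]
  refine ⟨by rw [hβ 0 (Nat.zero_le _), h.zero], fun i h0 hi => ?_, fun i h0 hi => ?_,
    fun i h0 hi => ?_, fun i hi => ?_⟩
  · rcases Nat.le_succ_iff.mp hi with hi | rfl
    · exact hp i hi ▸ h.p_pos i h0 hi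
    · exact hp0
  · rcases Nat.le_succ_iff.mp hi with hi | rfl
    · exact hq i hi ▸ h.q_pos i h0 hi
    · exact hq0
  · rcases Nat.le_succ_iff.mp hi with hi | rfl
    · rw [hp i hi, hq i hi]
      exact h.coprime i h0 hi
    · exact hpq
  · rw [hprod i (by omega), hβ i (by omega), hq i (by omega)]
    rcases Nat.lt_or_ge i N with hlt | hge
    · rw [hβ _ hlt, hp _ hlt, hq _ hlt]
      exact h.succ i hlt
    · obtain rfl : i = N := by omega
      exact hs

/-- The parameter $y_i$ is nonzero with positive value, being part of a regular system. This makes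
$T_{i+1}$ nonzero and $p_{i+1}$ positive; the exponents then come from the arithmetic of the values
and the constant from the residue field. -/
theorem exists_isJumpingRow_update (hS : RegularSystem ν S (x : K) y)
    (hx : ν (x : K) = ((1 : ℚ) : WithTop ℚ))
    (hres : ∀ f : K, ν f = 0 → ∃ c : k, IsResidue ν f c) (f : ℕ → JumpingRow S) (i : ℕ)
    (h : ∀ j ≤ i, IsJumpingRow ν x y f j) :
    ∃ a, IsJumpingRow ν x y (Function.update f (i + 1) a) (i + 1) := by
  obtain ⟨-, w, hw, -, -⟩ := IsJumpingRow.exists_regularSystem hS hx hres i h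
  have hz0 := hw.right_ne
  obtain ⟨s, hs⟩ := WithTop.ne_top_iff_exists.mp (ν.ne_top_of_ne_zero hz0)
  have hs0 : 0 < s := by
    have := hw.right_pos
    rw [← hs] at this
    -- Below, $s=\nu(y_i)$, and $Q_i s$ in lowest terms is $p_{i+1}/q_{i+1}$.
    exact_mod_cast this
  have hQ := IsJumpingRow.jumpingDenominator_pos h
  set r : ℚ := jumpingDenominator f i * s with hr
  have hr0 : 0 < r := mul_pos hQ hs0
  have hnum : 0 < r.num := Rat.num_pos.mpr hr0
  have hpq : ((r.num.toNat : ℕ) : ℚ) / r.den = r := by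
    have h1 : ((r.num.toNat : ℤ) : ℚ) = r.num := by rw [Int.toNat_of_nonneg hnum.le]
    rw [← Int.cast_natCast, h1, Rat.num_div_den]
  have hsr : s = 1 / jumpingDenominator f i * (((r.num.toNat : ℕ) : ℚ) / r.den) := by
    rw [hpq, hr]
    field_simp
  set t : S := if i = 0 then y else
    (f i).T ^ (f i).q - algebraMap k S (f i).c * jumpingMonomial f i with ht
  set b : ℚ := (if i = 0 then 0 else (f i).q * (f i).β) + s with hb
  have hmon := IsJumpingRow.jumpingMonomial_ne_zero (i := i) fun j hj => h j hj.le
  have htv : ν (t : K) = (b : WithTop ℚ) := by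
    rcases Nat.eq_zero_or_pos i with rfl | hi
    · have : jumpingParameter y f 0 = y := if_pos rfl
      rw [ht, hb, if_pos rfl, if_pos rfl, zero_add, hs, this]
    · have h1 : (t : K) = jumpingMonomial f i * jumpingParameter y f i := by
        rw [ht, if_neg hi.ne', jumpingParameter, if_neg hi.ne', mul_sub, mul_div_cancel₀ _ hmon,
          mul_comm (jumpingMonomial f i : K)]
        rfl
      rw [h1, AddValuation.map_mul, IsJumpingRow.value_jumpingMonomial hi h, ← hs, hb,
        if_neg hi.ne', WithTop.coe_add]
  have hvals := (isJumpingValues_of_isJumpingRow hx h).extend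
    (β' := Function.update (fun j => (f j).β) (i + 1) b)
    (p' := Function.update (fun j => (f j).p) (i + 1) r.num.toNat)
    (q' := Function.update (fun j => (f j).q) (i + 1) r.den)
    (fun j hj => Function.update_of_ne (by omega) _ _)
    (fun j hj => Function.update_of_ne (by omega) _ _)
    (fun j hj => Function.update_of_ne (by omega) _ _)
    (by rw [Function.update_self]; omega) (by rw [Function.update_self]; exact r.den_pos)
    (by
      rw [Function.update_self, Function.update_self]
      have := r.reduced
      rwa [show r.num.natAbs = r.num.toNat by omega] at this)
    (by
      rw [Function.update_self, Function.update_self, Function.update_self, hb]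
      nth_rewrite 1 [hsr]
      rfl)
  obtain ⟨n, hn, hsum⟩ := hvals.exists_exponents le_rfl
  rw [Function.update_self, Function.update_self] at hsum
  have hsum' : (r.den : ℚ) * b = ∑ j ∈ Finset.range (i + 1), (n j : ℚ) * (f j).β := by
    rw [hsum]
    refine Finset.sum_congr rfl fun j hj => ?_
    have := Finset.mem_range.mp hj
    rw [Function.update_of_ne (by omega)]
  have hprodv : ν (∏ j ∈ Finset.range (i + 1), ((f j).T : K) ^ n j) =
      ((r.den * b : ℚ) : WithTop ℚ) := by
    rw [hsum']
    exact ν.map_prod_pow _ _ fun j hj => (h j (Finset.mem_range_succ_iff.mp hj)).value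
  obtain ⟨c, hc⟩ := hres ((t : K) ^ r.den / ∏ j ∈ Finset.range (i + 1), ((f j).T : K) ^ n j) (by
    refine ν.map_div_eq_zero ?_ ?_
    · exact Finset.prod_ne_zero_iff.mpr fun j hj =>
        pow_ne_zero _ (h j (Finset.mem_range_succ_iff.mp hj)).coe_ne_zero
    · rw [hprodv, AddValuation.map_pow, htv, ← WithTop.coe_nsmul, nsmul_eq_mul])
  set a : JumpingRow S := ⟨t, b, r.num.toNat, r.den, n, c⟩ with ha
  have hg : ∀ j ≤ i, Function.update f (i + 1) a j = f j := fun j hj =>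
    Function.update_of_ne (by omega) _ _
  have hgi : Function.update f (i + 1) a (i + 1) = a := Function.update_self _ _ _
  refine ⟨a, ?_⟩
  set g := Function.update f (i + 1) a
  refine ⟨by rw [hgi]; exact htv, by omega, fun hi => ?_, fun _ => ?_, fun _ => ?_, fun _ => ?_,
    fun j hj hji => ?_, fun _ => ?_, fun _ => ?_, fun j hj hij => ?_⟩
  · obtain rfl : i = 0 := by omega
    rw [hgi]
    have ht0 : t = y := if_pos rfl
    refine ⟨ht0, ?_⟩
    change b = (r.num.toNat : ℚ) / r.den
    rw [hpq, hb, hr]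
    simp [jumpingDenominator]
  · rw [hgi]
    change 0 < r.num.toNat
    omega
  · rw [hgi]
    exact r.den_pos
  · rw [hgi]
    have := r.reduced
    rwa [show r.num.natAbs = r.num.toNat by omega] at this
  · rw [hgi, hg j (by omega)]
    have := hn j hj hji
    rwa [Function.update_of_ne (by omega)] at this
  · rw [hgi]
    refine hsum'.trans (Finset.sum_congr rfl fun j hj => ?_)
    rw [hg j (Finset.mem_range_succ_iff.mp hj)]
  · rw [coe_jumpingMonomial, hgi]
    convert hc using 2
    refine Finset.prod_congr rfl fun j hj => ?_
    rw [hg j (Finset.mem_range_succ_iff.mp hj)]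
  · obtain rfl : j = i := by omega
    have hm : jumpingMonomial g j = jumpingMonomial f j :=
      Finset.prod_congr rfl fun l hl => by
        rw [hg j le_rfl, hg l (Finset.mem_range.mp hl).le]
    have hprod : ∏ l ∈ Finset.Icc 1 j, ((g l).q : ℚ) = jumpingDenominator f j :=
      Finset.prod_congr rfl fun l hl => by rw [hg l (Finset.mem_Icc.mp hl).2]
    rw [hgi, hg j le_rfl, hm, hprod]
    refine ⟨if_neg hj.ne', ?_⟩
    change b = _ + 1 / jumpingDenominator f j * ((r.num.toNat : ℚ) / r.den)
    rw [hb, if_neg hj.ne', ← hsr]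

theorem nonempty_jumpingSequence (hS : RegularSystem ν S (x : K) y)
    (hx : ν (x : K) = ((1 : ℚ) : WithTop ℚ))
    (hres : ∀ f : K, ν f = 0 → ∃ c : k, IsResidue ν f c) : Nonempty (JumpingSequence ν x y) := by
  -- In row zero only the polynomial and its value carry meaning; the other entries are
  -- placeholders.
  let a : JumpingRow S := ⟨x, 1, 0, 0, 0, 0⟩
  have : Inhabited (JumpingRow S) := ⟨a⟩
  obtain ⟨f, hf⟩ := exists_forall_of_forall_exists_update (IsJumpingRow ν x y)
    (fun f g n hfg hf => hf.congr hfg) (fun f n hf => by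
      rcases n with _ | i
      · refine ⟨a, ?_⟩
        have h0 : Function.update f 0 a 0 = a := Function.update_self _ _ _
        refine ⟨by rw [h0]; exact hx, fun _ => by rw [h0], ?_, ?_, ?_, ?_, ?_, ?_, ?_, ?_⟩ <;>
          intros <;> omega
      · exact exists_isJumpingRow_update hS hx hres f i fun j hj => hf j (by omega))
  exact ⟨JumpingSequence.ofRows f hf⟩

end Construction

theorem theorem7p5 {k K : Type*} [Field k] [IsAlgClosed k] [CharZero k] [Field K] [Algebra k K]
    (htrdeg : Algebra.trdeg k K = 2)
    (ν : AddValuation K (WithTop ℚ)) (hν : IsKValuation k ν) (hν0 : IsZeroDimensional ν hν)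
    (S : Subalgebra k K) [Algebra.EssFiniteType k S] [IsFractionRing S K] [IsLocalRing S]
    (hS : IsDominated ν S)
    (x y : S) (hxy : IsRegularParameters x y) (hx : ν (x : K) = ((1 : ℚ) : WithTop ℚ)) :
    Nonempty (JumpingSequence ν x y) ∧
    ∀ J : JumpingSequence ν x y,
      ∃ (B : ℕ → Subalgebra k K) (hB : IsQuadraticSequence ν S B), ∀ i : ℕ, 0 < i →
        IsFreeRing (hB.le (J.index i)) x ∧
        ∃ xi yi : B (J.index i),
          IsRegularParameters xi yi ∧
          IsExceptional (hB.le (J.index i)) x xi ∧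
          (∀ j ≤ i, ∃ m : ℕ, (m : ℚ) = J.Q i * J.β j ∧
            ∃ γ : B (J.index i), IsUnit γ ∧ (J.T j : K) = (xi : K) ^ m * (γ : K)) ∧
          ν (xi : K) = ((1 / (J.Q i : ℚ) : ℚ) : WithTop ℚ) ∧
          (yi : K) = (J.T (i + 1) : K) / ∏ j ∈ Finset.range i, (J.T j : K) ^ J.n i j ∧
          IsStrictTransform (hB.le (J.index i)) (J.T (i + 1)) yi ∧
          ν (yi : K) =
            ((1 / (J.Q i : ℚ) * ((J.p (i + 1) : ℚ) / J.q (i + 1)) : ℚ) : WithTop ℚ) := by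
  have hres : ∀ f : K, ν f = 0 → ∃ c : k, IsResidue ν f c := fun f hf => exists_isResidue hν0 hf
  have hreg := RegularSystem.of_isRegularParameters hS hxy
  refine ⟨nonempty_jumpingSequence hreg hx hres, fun J => ?_⟩
  have hB := hreg.isQuadraticSequence hres
  refine ⟨_, hB, fun i hi => ?_⟩
  have hrow := J.isJumpingRow
  obtain ⟨-, w, hw, hwv, hmon⟩ :=
    IsJumpingRow.exists_regularSystem hreg hx hres i fun j _ => hrow j
  have hQ : jumpingDenominator J.row i = J.Q i := by
    rw [JumpingSequence.Q, Nat.cast_prod]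
    rfl
  have hQpos : (0 : ℚ) < J.Q i := by
    rw [← hQ]
    exact IsJumpingRow.jumpingDenominator_pos fun j _ => hrow j
  rw [hQ] at hwv
  have hexp : ∀ {j m : ℕ} {γ : K}, ν γ = 0 → (J.T j : K) = w ^ m * γ →
      (m : ℚ) = J.Q i * J.β j := by
    intro j m γ hγ0 hm
    have h1 := J.value j
    rw [hm, AddValuation.map_mul, AddValuation.map_pow, hγ0, add_zero, hwv,
      ← WithTop.coe_nsmul] at h1
    rw [← WithTop.coe_injective h1, nsmul_eq_mul]
    field_simp
  have hvals := isJumpingValues_of_isJumpingRow hx (N := i) fun j _ => hrow j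
  -- The exponent is $Q_i\beta_j>0$. For $j=0,1$ this makes `x` and `y` proper multiples of `w`, as
  -- freeness and the strict transform require.
  have hpos : ∀ {j m : ℕ} {γ : K}, j ≤ i → ν γ = 0 → (J.T j : K) = w ^ m * γ → m ≠ 0 := by
    rintro j m γ hj hγ0 hm rfl
    have h1 := hexp hγ0 hm
    have h2 : 0 < J.Q i * J.β j := mul_pos hQpos (hvals.pos hj)
    rw [← h1] at h2
    simp at h2
  obtain ⟨m₀, γ₀, hγ₀, hγ₀0, hm₀⟩ := hmon 0 (Nat.zero_le _)
  obtain ⟨m₁, γ₁, hγ₁, hγ₁0, hm₁⟩ := hmon 1 hi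
  have hm₀0 := hpos (Nat.zero_le _) hγ₀0 hm₀
  have hm₁0 := hpos hi hγ₁0 hm₁
  replace hm₀ : (x : K) = w ^ m₀ * γ₀ := by rw [← J.T_zero]; exact hm₀
  replace hm₁ : (y : K) = w ^ m₁ * γ₁ := by rw [← J.T_one]; exact hm₁
  obtain ⟨M, ε, hε, hε0, hM⟩ := exists_prod_pow_eq (Finset.range i) (J.row i).n
    fun j hj => hmon j (Finset.mem_range.mp hj).le
  have hT := IsJumpingRow.coe_succ (i := i) fun j _ => hrow j
  have hne := IsJumpingRow.jumpingMonomial_ne_zero (i := i) fun j _ => hrow j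
  rw [← coe_jumpingMonomial] at hM
  refine ⟨hw.isFreeRing (hB.le (J.index i)) hm₀0 hγ₀ hγ₀0 hm₀, ⟨w, hw.left_mem⟩,
    ⟨_, hw.right_mem⟩, hw.isRegularParameters,
    (hw.curvePreimage_eq (hB.le (J.index i)) hm₀0 hγ₀ hγ₀0 hm₀).ge, fun j hj => ?_, hwv, ?_, ?_, ?_⟩
  · obtain ⟨m, γ, hγ, hγ0, hm⟩ := hmon j hj
    exact ⟨m, hexp hγ0 hm, ⟨γ, hγ⟩, hw.isUnit_iff.mpr hγ0, hm⟩
  · refine eq_div_of_mul_eq ?_ ?_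
    · rw [coe_jumpingMonomial] at hne
      exact hne
    · rw [coe_jumpingMonomial] at hT
      exact hT.symm
  · rw [hM] at hT
    exact hreg.isStrictTransform hw (hB.le (J.index i)) hm₀0 hm₁0 hγ₀ hγ₀0 hγ₁ hm₀ hm₁ hε hε0 hT
  · rw [← hQ]
    exact IsJumpingRow.value_jumpingParameter fun j _ => hrow j
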